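/- Let $R$ be a commutative artinian ring and let $\Lambda$ be an artin $R$-algebra (an $R$-algebra that is finitely generated as an $R$-module). For such a ring, $\mathrm{mod}\,\Lambda$ denotes the category of finitely generated left $\Lambda$-modules. Let $K_0$ be the abelian group generated by the symbols $[M]$, $M\in\mathrm{mod}\,\Lambda$, modulo the relations $[C]=[A]+[B]$ if $C\simeq A\oplus B$, and $[P]=0$ if $P$ is projective. Let $\Omega:K_0\to K_0$ be the homomorphism induced by the syzygy, $\Omega([M])=[\Omega M]$, and for $M\in\mathrm{mod}\,\Lambda$ let $\langle\mathrm{add}\,M\rangle\subseteq K_0$ be the subgroup generated by the classes of the indecomposable direct summands of $M$. Then $\phi_l^\Lambda(M)$ is the smallest integer $n\ge 0$ such that $\Omega:\Omega^s\langle\mathrm{add}\,M\rangle\to\Omega^{s+1}\langle\mathrm{add}\,M\rangle$ is an isomorphism for all $s\ge n$, and $\phi_l\dim(\Lambda)=\sup\{\phi_l^\Lambda(M): M\in\mathrm{mod}\,\Lambda\}\in\mathbb N\cup\{\infty\}$. Dually, $\phi_r^\Lambda(M)$ and $\phi_r\dim(\Lambda)$ are defined with injective modules instead of projective ones and with cosyzygies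 $\Omega^{-1}M$ instead of syzygies. Let $\mathfrak A$ be a strong idempotent ideal of $\Lambda$, that is, a two-sided ideal such that for all $X,Y\in\mathrm{mod}\,\Lambda/\mathfrak A$ and all $i\ge 0$ the canonical map $\mathrm{Ext}^i_{\Lambda/\mathfrak A}(X,Y)\to\mathrm{Ext}^i_\Lambda(X,Y)$ is an isomorphism. (1) If the left $\Lambda$-module $\Lambda/\mathfrak A$ has finite projective dimension, then (a) $\phi_l^{\Lambda/\mathfrak A}(X)\le\phi_l^{\Lambda}(X)$ for all $X\in\mathrm{mod}\,\Lambda/\mathfrak A$, and (b) $\phi_l\dim(\Lambda/\mathfrak A)\le\phi_l\dim(\Lambda)$. (2) Dually, if the right $\Lambda$-module $\Lambda/\mathfrak A$ has finite projective dimension, then (a) $\phi_r^{\Lambda/\mathfrak A}(X)\le\phi_r^{\Lambda}(X)$ for all $X\in\mathrm{mod}\,\Lambda/\mathfrak A$, and (b) $\phi_r\dim(\Lambda/\mathfrak A)\le\phi_r\dim(\Lambda)$. -/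

import Mathlib

open CategoryTheory

universe u v

namespace IgusaTodorov

noncomputable section

/-! ### The stable Grothendieck groups of `mod Λ` -/

section StableGroup

variable {Λ : Type u} [Ring Λ]

/-- The relations imposed on the free abelian group on the finitely generated left `Λ`-modules:
`[C] = [A] + [B]` whenever `C ≃ A ⊕ B`, and `[Z] = 0` whenever `Z` belongs to the given class. -/
inductive StableRel (Null : FGModuleCat.{u} Λ → Prop) :
    FreeAbelianGroup (FGModuleCat.{u} Λ) → Prop
  | sum (A B C : FGModuleCat.{u} Λ) (e : C ≃ₗ[Λ] (A × B)) :
      StableRel Null (FreeAbelianGroup.of C - (FreeAbelianGroup.of A + FreeAbelianGroup.of B))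
  | null (Z : FGModuleCat.{u} Λ) (hZ : Null Z) : StableRel Null (FreeAbelianGroup.of Z)

/-- The abelian group generated by all symbols `[M]`, `M` in `mod Λ`, modulo the relations
`StableRel`. -/
abbrev StableK (Null : FGModuleCat.{u} Λ → Prop) : Type (u + 1) :=
  FreeAbelianGroup (FGModuleCat.{u} Λ) ⧸ AddSubgroup.closure {x | StableRel Null x}

/-- The class `[M]`. -/
def cls (Null : FGModuleCat.{u} Λ → Prop) (M : FGModuleCat.{u} Λ) : StableK Null :=
  QuotientAddGroup.mk (FreeAbelianGroup.of M)

/-- The module is projective. -/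
def Proj (P : FGModuleCat.{u} Λ) : Prop := Module.Projective Λ P

/-- The module is injective. -/
def Inj (I : FGModuleCat.{u} Λ) : Prop := Module.Injective Λ I

/-- `N` is a first syzygy of `M`: there is an exact sequence `0 → N → P → M → 0` in `mod Λ` with `P`
projective. (The kernel of a projective cover is one; any two become equal in the stable group.) -/
def IsSyzygy (M N : FGModuleCat.{u} Λ) : Prop :=
  ∃ (P : FGModuleCat.{u} Λ) (f : N →ₗ[Λ] P) (g : P →ₗ[Λ] M), Proj P ∧
    Function.Injective f ∧ Function.Exact f g ∧ Function.Surjective g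

/-- `N` is a first cosyzygy of `M`: there is an exact sequence `0 → M → I → N → 0` in `mod Λ` with
`I` injective. -/
def IsCosyzygy (M N : FGModuleCat.{u} Λ) : Prop :=
  ∃ (I : FGModuleCat.{u} Λ) (f : M →ₗ[Λ] I) (g : I →ₗ[Λ] N), Inj I ∧
    Function.Injective f ∧ Function.Exact f g ∧ Function.Surjective g

/-- The endomorphism `ω` of the stable group satisfies `ω [M] = [N]` whenever `N` is a (co)syzygy
of `M`. -/
def IsInduced (Null : FGModuleCat.{u} Λ → Prop)
    (Syz : FGModuleCat.{u} Λ → FGModuleCat.{u} Λ → Prop) (ω : StableK Null →+ StableK Null) : Prop :=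
  ∀ M N : FGModuleCat.{u} Λ, Syz M N → ω (cls Null M) = cls Null N

open Classical in
/-- The endomorphism of the stable group induced by the (co)syzygy. For an artin algebra it exists
and is unique, see `existsUnique_isInduced_syzygy` and `existsUnique_isInduced_cosyzygy`. -/
def inducedHom (Null : FGModuleCat.{u} Λ → Prop)
    (Syz : FGModuleCat.{u} Λ → FGModuleCat.{u} Λ → Prop) : StableK Null →+ StableK Null :=
  if h : ∃ ω, IsInduced Null Syz ω then h.choose else 0

/-! ### The Igusa-Todorov functions -/

/-- `N` is an indecomposable module. -/
def IsIndecomposable (N : FGModuleCat.{u} Λ) : Prop :=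
  Nontrivial N ∧ ∀ p q : Submodule Λ N, IsCompl p q → p = ⊥ ∨ q = ⊥

/-- `N` is isomorphic to a direct summand of `M`. -/
def IsSummand (N M : FGModuleCat.{u} Λ) : Prop :=
  ∃ L : FGModuleCat.{u} Λ, Nonempty (M ≃ₗ[Λ] (N × L))

/-- The subgroup `⟨add M⟩` generated by the classes of the indecomposable summands of `M`. -/
def addSpan (Null : FGModuleCat.{u} Λ → Prop) (M : FGModuleCat.{u} Λ) :
    AddSubgroup (StableK Null) :=
  AddSubgroup.closure {x | ∃ N, IsIndecomposable N ∧ IsSummand N M ∧ x = cls Null N}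

/-- For an endomorphism `ω` of an abelian group and a subgroup `H`, the smallest `n` such that
`ω : ω^s(H) → ω^(s+1)(H)` is an isomorphism for all `s ≥ n` (and `⊤` if there is none). -/
def stabIndex {K : Type*} [AddCommGroup K] (ω : K →+ K) (H : AddSubgroup K) : ℕ∞ :=
  ⨅ (n : ℕ) (_ : ∀ s, n ≤ s → Set.BijOn ω (ω^[s] '' (H : Set K)) (ω^[s + 1] '' (H : Set K))),
    (n : ℕ∞)

/-- The Igusa-Todorov function `φ_l`, defined by the syzygy. -/
def phiL (M : FGModuleCat.{u} Λ) : ℕ∞ :=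
  stabIndex (inducedHom Proj (IsSyzygy (Λ := Λ))) (addSpan Proj M)

/-- The dual Igusa-Todorov function `φ_r`, defined by the cosyzygy. -/
def phiR (M : FGModuleCat.{u} Λ) : ℕ∞ :=
  stabIndex (inducedHom Inj (IsCosyzygy (Λ := Λ))) (addSpan Inj M)

variable (Λ)

/-- The `φ_l`-dimension of `Λ`. -/
def phiLDim : ℕ∞ := ⨆ M : FGModuleCat.{u} Λ, phiL M

/-- The `φ_r`-dimension of `Λ`. -/
def phiRDim : ℕ∞ := ⨆ M : FGModuleCat.{u} Λ, phiR M

end StableGroup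

/-! ### Strong idempotent ideals -/

section Ideals

variable {Λ : Type u} [Ring Λ]

lemma restrictScalars_exact {Γ : Type u} [Ring Γ] (f : Λ →+* Γ) :
    Limits.PreservesFiniteLimits (ModuleCat.restrictScalars.{u} f) ∧
      Limits.PreservesFiniteColimits (ModuleCat.restrictScalars.{u} f) :=
  ((Functor.exact_tfae (ModuleCat.restrictScalars.{u} f)).out 1 3).mp fun S h => by
    rw [ShortComplex.ShortExact.moduleCat_exact_iff_function_exact] at h ⊢
    exact h

instance {Γ : Type u} [Ring Γ] (f : Λ →+* Γ) :
    Limits.PreservesFiniteLimits (ModuleCat.restrictScalars.{u} f) :=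
  (restrictScalars_exact f).1

instance {Γ : Type u} [Ring Γ] (f : Λ →+* Γ) :
    Limits.PreservesFiniteColimits (ModuleCat.restrictScalars.{u} f) :=
  (restrictScalars_exact f).2

variable (A : Ideal Λ) [A.IsTwoSided]

/-- The inclusion functor from `Λ/A`-modules to `Λ`-modules. -/
abbrev incl : ModuleCat.{u} (Λ ⧸ A) ⥤ ModuleCat.{u} Λ :=
  ModuleCat.restrictScalars (Ideal.Quotient.mk A)

/-- `A` is a strong idempotent ideal: for all `X`, `Y` in `mod Λ/A` and all `i ≥ 0` the canonical map
`Ext^i_{Λ/A}(X, Y) → Ext^i_Λ(X, Y)` is bijective. (For `i = 1` this contains `A * A = A`.) -/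
def IsStrongIdempotent : Prop :=
  ∀ (X Y : FGModuleCat.{u} (Λ ⧸ A)) (i : ℕ),
    Function.Bijective ((incl A).mapExtAddHom X.obj Y.obj i)

lemma finite_inflate (X : ModuleCat.{u} (Λ ⧸ A)) (h : Module.Finite (Λ ⧸ A) X) :
    Module.Finite Λ ((incl A).obj X) := by
  let _ : Module (Λ ⧸ A) ((incl A).obj X) := X.isModule
  have : IsScalarTower Λ (Λ ⧸ A) ((incl A).obj X) :=
    ⟨fun a b x => mul_smul (Ideal.Quotient.mk A a) b (show X from x)⟩
  have : Module.Finite (Λ ⧸ A) ((incl A).obj X) := h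
  exact Module.Finite.trans (Λ ⧸ A) _

variable {A} in
/-- A finitely generated `Λ/A`-module, viewed in `mod Λ`. -/
def inflate (X : FGModuleCat.{u} (Λ ⧸ A)) : FGModuleCat.{u} Λ :=
  ⟨(incl A).obj X.obj, finite_inflate A X.obj X.property⟩

/-- `Λ/A` as a left `Λ`-module. -/
abbrev leftQuot : ModuleCat.{u} Λ := ModuleCat.of Λ (Λ ⧸ A)

/-- `Λ/A` as a right `Λ`-module, that is, as a left module over the opposite ring. -/
abbrev rightQuot : ModuleCat.{u} Λᵐᵒᵖ :=
  (ModuleCat.restrictScalars (RingHom.op (Ideal.Quotient.mk A))).obj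
    (ModuleCat.of (Λ ⧸ A)ᵐᵒᵖ (Λ ⧸ A))

end Ideals

/-! ### The endomorphisms induced by syzygies and cosyzygies are well defined -/

section WellDefined

variable {Λ : Type u} [Ring Λ] {Null : FGModuleCat.{u} Λ → Prop}

lemma cls_sum {A B C : FGModuleCat.{u} Λ} (e : C ≃ₗ[Λ] (A × B)) :
    cls Null C = cls Null A + cls Null B := by
  rw [← sub_eq_zero]
  exact (QuotientAddGroup.eq_zero_iff _).2 (AddSubgroup.subset_closure (StableRel.sum A B C e))

lemma cls_null {Z : FGModuleCat.{u} Λ} (h : Null Z) : cls Null Z = 0 :=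
  (QuotientAddGroup.eq_zero_iff _).2 (AddSubgroup.subset_closure (StableRel.null Z h))

lemma hom_ext_cls {ω ω' : StableK Null →+ StableK Null}
    (h : ∀ M, ω (cls Null M) = ω' (cls Null M)) : ω = ω' := by
  apply QuotientAddGroup.addMonoidHom_ext
  ext M
  exact h M

lemma existsUnique_isInduced (Syz : FGModuleCat.{u} Λ → FGModuleCat.{u} Λ → Prop)
    (ex : ∀ M, ∃ N, Syz M N)
    (uniq : ∀ M N N', Syz M N → Syz M N' → cls Null N = cls Null N')
    (sum : ∀ A B C A' B' : FGModuleCat.{u} Λ, Nonempty (C ≃ₗ[Λ] (A × B)) → Syz A A' → Syz B B' →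
      ∃ C', Syz C C' ∧ cls Null C' = cls Null A' + cls Null B')
    (null : ∀ Z, Null Z → ∃ N, Syz Z N ∧ cls Null N = 0) :
    ∃! ω, IsInduced Null Syz ω := by
  choose s hs using ex
  have hle : AddSubgroup.closure {x | StableRel Null x} ≤
      (FreeAbelianGroup.lift fun M => cls Null (s M)).ker := by
    rw [AddSubgroup.closure_le]
    rintro _ (⟨A, B, C, e⟩ | ⟨Z, hZ⟩)
    · obtain ⟨C', h1, h2⟩ := sum A B C _ _ ⟨e⟩ (hs A) (hs B)
      simp [AddMonoidHom.mem_ker, uniq _ _ _ (hs C) h1, h2]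
    · obtain ⟨N, h1, h2⟩ := null Z hZ
      simp [AddMonoidHom.mem_ker, uniq _ _ _ (hs Z) h1, h2]
  refine ⟨QuotientAddGroup.lift _ (FreeAbelianGroup.lift fun M => cls Null (s M)) hle, ?_, ?_⟩
  · intro M N h
    rw [← uniq _ _ _ (hs M) h]
    exact (QuotientAddGroup.lift_mk _ hle _).trans (FreeAbelianGroup.lift_apply_of _ _)
  · intro ω hω
    apply hom_ext_cls
    intro M
    rw [hω _ _ (hs M)]
    exact ((QuotientAddGroup.lift_mk _ hle _).trans (FreeAbelianGroup.lift_apply_of _ _)).symm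

/-- A split short exact sequence with projective cokernel. -/
lemma exists_equiv_of_projective {K L P : Type u} [AddCommGroup K] [AddCommGroup L] [AddCommGroup P]
    [Module Λ K] [Module Λ L] [Module Λ P] [Module.Projective Λ P] (f : K →ₗ[Λ] L) (g : L →ₗ[Λ] P)
    (hf : Function.Injective f) (hfg : Function.Exact f g) (hg : Function.Surjective g) :
    Nonempty (L ≃ₗ[Λ] (K × P)) := by
  obtain ⟨s, hs⟩ := Module.projective_lifting_property g LinearMap.id hg
  exact ⟨(hfg.splitSurjectiveEquiv hf ⟨s, hs⟩).1⟩

/-- A split short exact sequence with injective kernel. -/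
lemma exists_equiv_of_injective {I L C : Type u} [AddCommGroup I] [AddCommGroup L] [AddCommGroup C]
    [Module Λ I] [Module Λ L] [Module Λ C] [Module.Injective Λ I] (f : I →ₗ[Λ] L) (g : L →ₗ[Λ] C)
    (hf : Function.Injective f) (hfg : Function.Exact f g) (hg : Function.Surjective g) :
    Nonempty (L ≃ₗ[Λ] (I × C)) := by
  obtain ⟨s, hs⟩ := Module.Injective.extension_property Λ I I L f hf LinearMap.id
  exact ⟨(hfg.splitInjectiveEquiv hg ⟨s, hs⟩).1⟩

lemma isSyzygy_sum (A B C A' B' : FGModuleCat.{u} Λ) (e : C ≃ₗ[Λ] (A × B))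
    (hA : IsSyzygy A A') (hB : IsSyzygy B B') :
    IsSyzygy C (FGModuleCat.of Λ (A' × B')) := by
  obtain ⟨P, f, g, hP, hf, hfg, hg⟩ := hA
  obtain ⟨Q, f', g', hQ, hf', hfg', hg'⟩ := hB
  have : Module.Projective Λ P := hP
  have : Module.Projective Λ Q := hQ
  refine ⟨FGModuleCat.of Λ (P × Q), f.prodMap f', e.symm.toLinearMap ∘ₗ g.prodMap g',
    inferInstanceAs (Module.Projective Λ (P × Q)), hf.prodMap hf', ?_,
    e.symm.surjective.comp (hg.prodMap hg')⟩
  rintro ⟨x, y⟩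
  have h1 := hfg x
  have h2 := hfg' y
  constructor
  · intro h
    have h0 : (g x, g' y) = (0 : A × B) := e.symm.map_eq_zero_iff.1 h
    obtain ⟨a, ha⟩ := h1.1 (congrArg Prod.fst h0)
    obtain ⟨b, hb⟩ := h2.1 (congrArg Prod.snd h0)
    exact ⟨(a, b), Prod.ext ha hb⟩
  · rintro ⟨⟨a, b⟩, hab⟩
    refine e.symm.map_eq_zero_iff.2 (Prod.ext (h1.2 ⟨a, ?_⟩) (h2.2 ⟨b, ?_⟩))
    · exact congrArg Prod.fst hab
    · exact congrArg Prod.snd hab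

lemma isCosyzygy_sum (A B C A' B' : FGModuleCat.{u} Λ) (e : C ≃ₗ[Λ] (A × B))
    (hA : IsCosyzygy A A') (hB : IsCosyzygy B B') :
    IsCosyzygy C (FGModuleCat.of Λ (A' × B')) := by
  obtain ⟨P, f, g, hP, hf, hfg, hg⟩ := hA
  obtain ⟨Q, f', g', hQ, hf', hfg', hg'⟩ := hB
  have : Module.Injective Λ P := hP
  have : Module.Injective Λ Q := hQ
  have hPQ : Module.Injective Λ (P × Q) := by
    refine ⟨fun X Y _ _ _ _ i hi j => ?_⟩
    obtain ⟨a, ha⟩ := hP.out i hi (LinearMap.fst Λ P Q ∘ₗ j)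
    obtain ⟨b, hb⟩ := hQ.out i hi (LinearMap.snd Λ P Q ∘ₗ j)
    exact ⟨a.prod b, fun x => Prod.ext (ha x) (hb x)⟩
  refine ⟨FGModuleCat.of Λ (P × Q), f.prodMap f' ∘ₗ e.toLinearMap, g.prodMap g',
    hPQ, (hf.prodMap hf').comp e.injective, ?_, hg.prodMap hg'⟩
  rintro ⟨x, y⟩
  have h1 := hfg x
  have h2 := hfg' y
  constructor
  · intro h
    obtain ⟨a, ha⟩ := h1.1 (congrArg Prod.fst h)
    obtain ⟨b, hb⟩ := h2.1 (congrArg Prod.snd h)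
    refine ⟨e.symm (a, b), ?_⟩
    change (f.prodMap f') (e (e.symm (a, b))) = (x, y)
    rw [e.apply_symm_apply]
    exact Prod.ext ha hb
  · rintro ⟨c, hc⟩
    refine Prod.ext (h1.2 ⟨(e c).1, ?_⟩) (h2.2 ⟨(e c).2, ?_⟩)
    · exact congrArg Prod.fst hc
    · exact congrArg Prod.snd hc

/-- Schanuel's lemma. -/
lemma isSyzygy_unique (M N N' : FGModuleCat.{u} Λ) (h : IsSyzygy M N) (h' : IsSyzygy M N') :
    cls Proj N = cls Proj N' := by
  obtain ⟨P, f, g, hP, hf, hfg, hg⟩ := h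
  obtain ⟨Q, f', g', hQ, hf', hfg', hg'⟩ := h'
  have : Module.Projective Λ P := hP
  have : Module.Projective Λ Q := hQ
  let D : P × Q →ₗ[Λ] M := g.coprod (-g')
  have hD : ∀ p q, (p, q) ∈ D.ker ↔ g p = g' q := fun p q => by
    simp [D, ← sub_eq_add_neg, sub_eq_zero]
  obtain ⟨e₁⟩ : Nonempty (D.ker ≃ₗ[Λ] (N × Q)) := by
    refine exists_equiv_of_projective
      ((LinearMap.inl Λ P Q ∘ₗ f).codRestrict D.ker fun n => ?_)
      (LinearMap.snd Λ P Q ∘ₗ D.ker.subtype) ?_ ?_ ?_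
    · exact (hD _ _).2 (by simpa using hfg.apply_apply_eq_zero n)
    · intro a b hab
      exact hf (congrArg (fun z : D.ker => z.1.1) hab)
    · rintro ⟨⟨p, q⟩, hpq⟩
      have hpq' := (hD p q).1 hpq
      constructor
      · rintro (rfl : q = 0)
        obtain ⟨n, rfl⟩ := (hfg p).1 (by simpa using hpq')
        exact ⟨n, rfl⟩
      · rintro ⟨n, hn⟩
        exact (congrArg (fun z : D.ker => z.1.2) hn).symm
    · intro q
      obtain ⟨p, hp⟩ := hg (g' q)
      exact ⟨⟨(p, q), (hD _ _).2 hp⟩, rfl⟩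
  obtain ⟨e₂⟩ : Nonempty (D.ker ≃ₗ[Λ] (N' × P)) := by
    refine exists_equiv_of_projective
      ((LinearMap.inr Λ P Q ∘ₗ f').codRestrict D.ker fun n => ?_)
      (LinearMap.fst Λ P Q ∘ₗ D.ker.subtype) ?_ ?_ ?_
    · exact (hD _ _).2 (by simpa using (hfg'.apply_apply_eq_zero n).symm)
    · intro a b hab
      exact hf' (congrArg (fun z : D.ker => z.1.2) hab)
    · rintro ⟨⟨p, q⟩, hpq⟩
      have hpq' := (hD p q).1 hpq
      constructor
      · rintro (rfl : p = 0)
        obtain ⟨n, rfl⟩ := (hfg' q).1 (by simpa using hpq'.symm)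
        exact ⟨n, rfl⟩
      · rintro ⟨n, hn⟩
        exact (congrArg (fun z : D.ker => z.1.1) hn).symm
    · intro p
      obtain ⟨q, hq⟩ := hg' (g p)
      exact ⟨⟨(p, q), (hD _ _).2 hq.symm⟩, rfl⟩
  have k₁ := cls_sum (Null := Proj) (A := N) (B := Q) (C := FGModuleCat.of Λ (N × Q))
    (LinearEquiv.refl _ _)
  have k₂ := cls_sum (Null := Proj) (A := N') (B := P) (C := FGModuleCat.of Λ (N × Q))
    (e₁.symm.trans e₂)
  rw [cls_null hQ, add_zero] at k₁
  rw [cls_null hP, add_zero] at k₂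
  exact k₁.symm.trans k₂

/-- The dual of Schanuel's lemma. -/
lemma isCosyzygy_unique (M N N' : FGModuleCat.{u} Λ) (h : IsCosyzygy M N) (h' : IsCosyzygy M N') :
    cls Inj N = cls Inj N' := by
  obtain ⟨P, f, g, hP, hf, hfg, hg⟩ := h
  obtain ⟨Q, f', g', hQ, hf', hfg', hg'⟩ := h'
  have : Module.Injective Λ P := hP
  have : Module.Injective Λ Q := hQ
  let W : Submodule Λ (P × Q) := (f.prod f').range
  have hW : ∀ p q, (p, q) ∈ W ↔ ∃ m, f m = p ∧ f' m = q := fun p q => by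
    simp [W, LinearMap.mem_range]
  obtain ⟨e₁⟩ : Nonempty (((P × Q) ⧸ W) ≃ₗ[Λ] (Q × N)) := by
    refine exists_equiv_of_injective (W.mkQ ∘ₗ LinearMap.inr Λ P Q)
      (W.liftQ (g ∘ₗ LinearMap.fst Λ P Q) ?_) ?_ ?_ ?_
    · rintro ⟨p, q⟩ hpq
      obtain ⟨m, rfl, rfl⟩ := (hW p q).1 hpq
      simpa using hfg.apply_apply_eq_zero m
    · rw [← LinearMap.ker_eq_bot, LinearMap.ker_eq_bot']
      intro q hq
      obtain ⟨m, h1, h2⟩ := (hW 0 q).1 ((Submodule.Quotient.mk_eq_zero W).1 hq)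
      rw [hf (h1.trans (map_zero f).symm), map_zero] at h2
      exact h2.symm
    · intro z
      obtain ⟨⟨p, q⟩, rfl⟩ := W.mkQ_surjective z
      constructor
      · intro hz
        obtain ⟨m, rfl⟩ := (hfg p).1 hz
        refine ⟨q - f' m, (Submodule.Quotient.eq W).2 ((hW _ _).2 ⟨-m, ?_⟩)⟩
        simp
      · rintro ⟨q', hq'⟩
        rw [← hq']
        exact map_zero g
    · intro n
      obtain ⟨p, rfl⟩ := hg n
      exact ⟨W.mkQ (p, 0), rfl⟩
  obtain ⟨e₂⟩ : Nonempty (((P × Q) ⧸ W) ≃ₗ[Λ] (P × N')) := by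
    refine exists_equiv_of_injective (W.mkQ ∘ₗ LinearMap.inl Λ P Q)
      (W.liftQ (g' ∘ₗ LinearMap.snd Λ P Q) ?_) ?_ ?_ ?_
    · rintro ⟨p, q⟩ hpq
      obtain ⟨m, rfl, rfl⟩ := (hW p q).1 hpq
      simpa using hfg'.apply_apply_eq_zero m
    · rw [← LinearMap.ker_eq_bot, LinearMap.ker_eq_bot']
      intro p hp
      obtain ⟨m, h1, h2⟩ := (hW p 0).1 ((Submodule.Quotient.mk_eq_zero W).1 hp)
      rw [hf' (h2.trans (map_zero f').symm), map_zero] at h1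
      exact h1.symm
    · intro z
      obtain ⟨⟨p, q⟩, rfl⟩ := W.mkQ_surjective z
      constructor
      · intro hz
        obtain ⟨m, rfl⟩ := (hfg' q).1 hz
        refine ⟨p - f m, (Submodule.Quotient.eq W).2 ((hW _ _).2 ⟨-m, ?_⟩)⟩
        simp
      · rintro ⟨p', hp'⟩
        rw [← hp']
        exact map_zero g'
    · intro n
      obtain ⟨q, rfl⟩ := hg' n
      exact ⟨W.mkQ (0, q), rfl⟩
  have k₁ := cls_sum (Null := Inj) (A := Q) (B := N) (C := FGModuleCat.of Λ (Q × N))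
    (LinearEquiv.refl _ _)
  have k₂ := cls_sum (Null := Inj) (A := P) (B := N') (C := FGModuleCat.of Λ (Q × N))
    (e₁.symm.trans e₂)
  rw [cls_null hQ, zero_add] at k₁
  rw [cls_null hP, zero_add] at k₂
  exact k₁.symm.trans k₂

theorem existsUnique_isInduced_syzygy [IsNoetherianRing Λ] :
    ∃! ω, IsInduced Proj (IsSyzygy (Λ := Λ)) ω := by
  refine existsUnique_isInduced _ (fun M => ?_) isSyzygy_unique ?_ ?_
  · obtain ⟨n, g, hg⟩ := Module.Finite.exists_fin' Λ M
    exact ⟨FGModuleCat.of Λ g.ker, FGModuleCat.of Λ (Fin n → Λ), g.ker.subtype, g,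
      inferInstanceAs (Module.Projective Λ (Fin n → Λ)), g.ker.injective_subtype,
      LinearMap.exact_subtype_ker_map g, hg⟩
  · rintro A B C A' B' ⟨e⟩ hA hB
    exact ⟨_, isSyzygy_sum A B C A' B' e hA hB, cls_sum (LinearEquiv.refl _ _)⟩
  · intro Z hZ
    refine ⟨FGModuleCat.of Λ PUnit, ⟨Z, 0, LinearMap.id, hZ, ?_, ?_, fun x => ⟨x, rfl⟩⟩, ?_⟩
    · exact fun _ _ _ => rfl
    · intro x
      exact ⟨fun h => ⟨0, h.symm⟩, fun ⟨_, h⟩ => h.symm⟩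
    · exact cls_null (inferInstanceAs (Module.Projective Λ PUnit.{u + 1}))

theorem existsUnique_isInduced_cosyzygy_of_enough
    (ex : ∀ M : FGModuleCat.{u} Λ, ∃ (I : FGModuleCat.{u} Λ) (f : M →ₗ[Λ] I),
      Inj I ∧ Function.Injective f) :
    ∃! ω, IsInduced Inj (IsCosyzygy (Λ := Λ)) ω := by
  refine existsUnique_isInduced _ (fun M => ?_) isCosyzygy_unique ?_ ?_
  · obtain ⟨I, f, hI, hf⟩ := ex M
    exact ⟨FGModuleCat.of Λ (I ⧸ f.range), I, f, f.range.mkQ, hI, hf,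
      LinearMap.exact_map_mkQ_range f, f.range.mkQ_surjective⟩
  · rintro A B C A' B' ⟨e⟩ hA hB
    exact ⟨_, isCosyzygy_sum A B C A' B' e hA hB, cls_sum (LinearEquiv.refl _ _)⟩
  · intro Z hZ
    refine ⟨FGModuleCat.of Λ PUnit, ⟨Z, LinearMap.id, 0, hZ, fun _ _ h => h, ?_, ?_⟩, ?_⟩
    · intro x
      exact ⟨fun _ => ⟨x, rfl⟩, fun _ => rfl⟩
    · exact fun _ => ⟨0, rfl⟩
    · exact cls_null ⟨fun _ _ _ _ _ _ _ _ _ => ⟨0, fun _ => rfl⟩⟩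

/-- Over a left noetherian ring, `inducedHom Proj IsSyzygy` is the homomorphism `[M] ↦ [Ω M]`. -/
theorem isInduced_inducedHom_syzygy [IsNoetherianRing Λ] :
    IsInduced Proj (IsSyzygy (Λ := Λ)) (inducedHom Proj IsSyzygy) := by
  have h := (existsUnique_isInduced_syzygy (Λ := Λ)).exists
  rw [inducedHom, dif_pos h]
  exact h.choose_spec

end WellDefined

/-! ### Finitely generated injective modules over an artin algebra -/

section EnoughInjectives

variable {Λ : Type u} [Ring Λ]

/-- Every nonzero element of `N` has a nonzero multiple in `M`. -/
def EssOver {E : Type u} [AddCommGroup E] [Module Λ E] (M N : Submodule Λ E) : Prop :=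
  ∀ x ∈ N, x ≠ 0 → ∃ a : Λ, a • x ∈ M ∧ a • x ≠ 0

/-- Inside an injective module every submodule has an injective hull. -/
lemma exists_hull {E : Type u} [AddCommGroup E] [Module Λ E] [hE : Module.Injective Λ E]
    (M : Submodule Λ E) :
    ∃ N : Submodule Λ E, M ≤ N ∧ EssOver M N ∧ Module.Injective Λ N := by
  obtain ⟨N, hMN, hN⟩ := zorn_le_nonempty₀ {N : Submodule Λ E | EssOver M N} (by
    intro c hc hcc y hy
    refine ⟨sSup c, ?_, fun z hz => le_sSup hz⟩
    intro x hx hx0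
    obtain ⟨N, hNc, hxN⟩ := (Submodule.mem_sSup_of_directed ⟨y, hy⟩ hcc.directedOn).1 hx
    exact hc hNc x hxN hx0) M (fun x hx hx0 => ⟨1, by simpa using hx, by simpa using hx0⟩)
  obtain ⟨C, -, hC⟩ := zorn_le_nonempty₀ {C : Submodule Λ E | ∀ x ∈ C, x ∈ N → x = 0} (by
    intro c hc hcc y hy
    refine ⟨sSup c, ?_, fun z hz => le_sSup hz⟩
    intro x hx hxN
    obtain ⟨D, hDc, hxD⟩ := (Submodule.mem_sSup_of_directed ⟨y, hy⟩ hcc.directedOn).1 hx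
    exact hc hDc x hxD hxN) ⊥ (fun x hx _ => by simpa using hx)
  have hCN : ∀ x ∈ C, x ∈ N → x = 0 := hC.prop
  have hess : EssOver M N := hN.prop
  -- `N → E / C` is essential
  have key : ∀ e : E, e ∉ C → ∃ a : Λ, ∃ n ∈ N, n ≠ 0 ∧ C.mkQ (a • e) = C.mkQ n := by
    intro e he
    by_contra! hcon
    apply he
    have hmem : (C ⊔ Submodule.span Λ {e}) ∈ {C : Submodule Λ E | ∀ x ∈ C, x ∈ N → x = 0} := by
      intro x hx hxN
      obtain ⟨c, hc, z, hz, rfl⟩ := Submodule.mem_sup.1 hx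
      obtain ⟨a, rfl⟩ := Submodule.mem_span_singleton.1 hz
      by_contra h0
      refine hcon a _ hxN h0 ((Submodule.Quotient.eq C).2 ?_)
      simpa using hc
    exact hC.le_of_ge hmem le_sup_left
      (Submodule.mem_sup_right (Submodule.mem_span_singleton_self e))
  have hinj : Function.Injective (C.mkQ ∘ₗ N.subtype) := by
    rw [← LinearMap.ker_eq_bot, LinearMap.ker_eq_bot']
    intro x hx
    exact Subtype.ext (hCN x ((Submodule.Quotient.mk_eq_zero C).1 hx) x.2)
  obtain ⟨h, hh⟩ := hE.out (C.mkQ ∘ₗ N.subtype) hinj N.subtype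
  have hh' : ∀ n ∈ N, h (C.mkQ n) = n := fun n hn => hh ⟨n, hn⟩
  have hrange : h.range ∈ {N : Submodule Λ E | EssOver M N} := by
    rintro _ ⟨y, rfl⟩ hy0
    obtain ⟨e, rfl⟩ := C.mkQ_surjective y
    have he : e ∉ C := fun he => hy0 (by
      rw [show C.mkQ e = 0 from (Submodule.Quotient.mk_eq_zero C).2 he, map_zero])
    obtain ⟨a, n, hn, hn0, han⟩ := key e he
    obtain ⟨b, hb, hb0⟩ := hess n hn hn0
    have : (b * a) • h (C.mkQ e) = b • n := by
      rw [mul_smul, ← map_smul h, ← map_smul C.mkQ, han, hh' n hn]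
    exact ⟨b * a, this ▸ hb, this ▸ hb0⟩
  have hle : h.range ≤ N := hN.le_of_ge hrange fun n hn => ⟨_, hh' n hn⟩
  refine ⟨N, hMN, hess, ⟨fun X Y _ _ _ _ i hi j => ?_⟩⟩
  obtain ⟨k, hk⟩ := hE.out i hi (N.subtype ∘ₗ j)
  refine ⟨(h.codRestrict N fun y => hle ⟨y, rfl⟩) ∘ₗ C.mkQ ∘ₗ k, fun x => Subtype.ext ?_⟩
  change h (C.mkQ (k (i x))) = j x
  rw [hk x]
  exact hh' _ (j x).2

/-- An essential extension of a finitely generated module over an artin algebra is finitely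
generated. -/
lemma finite_of_essOver (R : Type v) [CommRing R] [IsArtinianRing R] [Algebra R Λ]
    [Module.Finite R Λ] {E : Type u} [AddCommGroup E] [Module Λ E] (M N : Submodule Λ E)
    (hM : M.FG) (hess : EssOver M N) : Module.Finite Λ N := by
  let _ : Module R E := Module.compHom E (algebraMap R Λ)
  have : IsScalarTower R Λ E := IsScalarTower.of_algebraMap_smul fun _ _ => rfl
  have : IsArtinianRing Λ := IsArtinianRing.of_finite R Λ
  have hsp : IsSemiprimaryRing Λ := inferInstance
  let J : Ideal Λ := Ring.jacobson Λ
  have hss : IsSemisimpleRing (Λ ⧸ J) := hsp.isSemisimpleRing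
  obtain ⟨n, hn⟩ : IsNilpotent J := hsp.isNilpotent
  have : Module.Finite Λ M := Module.Finite.of_fg hM
  have : Module.Finite R M := Module.Finite.trans Λ M
  have hMn : IsNoetherian R M := inferInstance
  have h1 : ∀ T : Submodule Λ E, T ≤ N → (∀ a ∈ J, ∀ x ∈ T, a • x = 0) → T ≤ M := by
    intro T hTN hT
    have htor : Module.IsTorsionBySet Λ T J := fun x a => Subtype.ext (hT a a.2 x x.2)
    let _ := htor.module
    have : IsSemisimpleModule Λ T := htor.isSemisimpleModule_iff.1 inferInstance
    obtain ⟨D, hD⟩ := exists_isCompl (M.comap T.subtype)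
    have hD0 : D = ⊥ := by
      rw [eq_bot_iff]
      intro x hx
      by_contra hx0
      obtain ⟨a, ha, ha0⟩ := hess x (hTN x.2) fun h => hx0 (by
        rw [Submodule.mem_bot]; exact Subtype.ext h)
      have := Submodule.disjoint_def.1 hD.disjoint (a • x) ha (D.smul_mem a hx)
      exact ha0 (congrArg Subtype.val this)
    have := hD.sup_eq_top
    rw [hD0, sup_bot_eq] at this
    intro x hx
    have h : (⟨x, hx⟩ : T) ∈ M.comap T.subtype := this ▸ Submodule.mem_top
    exact h
  obtain ⟨m, g, hg⟩ : ∃ (m : ℕ) (g : Fin m → Λ),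
      Submodule.span R (Set.range g) = J.restrictScalars R :=
    Submodule.fg_iff_exists_fin_generating_family.1 (IsNoetherian.noetherian _)
  have hgJ : ∀ k, g k ∈ J := fun k => by
    have : g k ∈ J.restrictScalars R := hg ▸ Submodule.subset_span ⟨k, rfl⟩
    exact this
  have h2 : ∀ (k : ℕ) (T : Submodule Λ E), T ≤ N → (∀ a ∈ J ^ k, ∀ x ∈ T, a • x = 0) →
      IsNoetherian R T := by
    intro k
    induction k with
    | zero =>
      intro T _ hT
      have : Subsingleton T := ⟨fun x y => Subtype.ext (by
        have hx := hT 1 (by rw [Submodule.pow_zero, Ideal.one_eq_top]; exact Submodule.mem_top) x x.2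
        have hy := hT 1 (by rw [Submodule.pow_zero, Ideal.one_eq_top]; exact Submodule.mem_top) y y.2
        rw [one_smul] at hx hy
        rw [hx, hy])⟩
      infer_instance
    | succ k ih =>
      intro T hTN hT
      let T' : Submodule Λ E := J • T
      have hT'T : T' ≤ T := Submodule.smul_le_right
      have hT' : IsNoetherian R T' := by
        refine ih T' (hT'T.trans hTN) fun a ha x hx => ?_
        have hx' : x ∈ J • T := hx
        refine Submodule.smul_induction_on (p := fun x => a • x = 0) hx' ?_ ?_
        · intro r hr y hy
          rw [smul_smul]
          exact hT _ (by rw [Submodule.pow_succ]; exact Ideal.mul_mem_mul ha hr) y hy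
        · intro y z hy hz
          rw [smul_add, hy, hz, add_zero]
      let F : T →ₗ[R] (Fin m → T') :=
        { toFun := fun x i => ⟨g i • (x : E), Submodule.smul_mem_smul (hgJ i) x.2⟩
          map_add' := fun x y => by
            funext i; exact Subtype.ext (smul_add _ _ _)
          map_smul' := fun r x => by
            funext i; exact Subtype.ext (smul_algebra_smul_comm r (g i) (x : E)) }
      have hker : ∀ x : T, F x = 0 → (x : E) ∈ M := by
        intro x hx
        have hgx : ∀ i, g i • (x : E) = 0 := fun i => congrArg Subtype.val (congrFun hx i)
        have hJx : ∀ a ∈ J, a • (x : E) = 0 := by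
          intro a ha
          have ha' : a ∈ Submodule.span R (Set.range g) := by rw [hg]; exact ha
          clear ha
          induction ha' using Submodule.span_induction with
          | mem a h => obtain ⟨i, rfl⟩ := h; exact hgx i
          | zero => exact zero_smul _ _
          | add a b _ _ h1 h2 => rw [add_smul, h1, h2, add_zero]
          | smul r a _ h => rw [smul_assoc, h, smul_zero]
        refine h1 (Submodule.span Λ {(x : E)}) ?_ ?_ (Submodule.mem_span_singleton_self _)
        · rw [Submodule.span_singleton_le_iff_mem]; exact hTN x.2
        · intro a ha y hy
          obtain ⟨b, rfl⟩ := Submodule.mem_span_singleton.1 hy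
          rw [smul_smul]
          exact hJx _ (Ideal.mul_mem_right b J ha)
      have hkn : IsNoetherian R F.ker := by
        let G : F.ker →ₗ[R] M :=
          { toFun := fun x => ⟨(x : T), hker x x.2⟩
            map_add' := fun _ _ => rfl
            map_smul' := fun _ _ => rfl }
        exact isNoetherian_of_injective G fun x y h =>
          Subtype.ext (Subtype.ext (congrArg (fun z : M => (z : E)) h))
      exact isNoetherian_of_range_eq_ker F.ker.subtype F (by simp)
  have := h2 n N le_rfl fun a ha x _ => by
    rw [hn] at ha
    rw [show a = 0 from ha, zero_smul]
  have : Module.Finite R N := inferInstance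
  exact Module.Finite.of_restrictScalars_finite R Λ N

theorem existsUnique_isInduced_cosyzygy (R : Type v) [CommRing R] [IsArtinianRing R] [Algebra R Λ]
    [Module.Finite R Λ] : ∃! ω, IsInduced Inj (IsCosyzygy (Λ := Λ)) ω := by
  refine existsUnique_isInduced_cosyzygy_of_enough fun M => ?_
  have := ModuleCat.enoughInjectives.{u, u} Λ
  obtain ⟨⟨E, hE, i, hi⟩⟩ := EnoughInjectives.presentation M.obj
  have hE' : Module.Injective Λ E := (Module.injective_iff_injective_object Λ E).2 hE
  have hi' : Function.Injective i.hom := (ModuleCat.mono_iff_injective i).1 hi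
  obtain ⟨N, hMN, hess, hN⟩ := exists_hull i.hom.range
  have hfin := finite_of_essOver R i.hom.range N
    (by rw [← Submodule.map_top]; exact Module.Finite.fg_top.map _) hess
  exact ⟨FGModuleCat.of Λ N, i.hom.codRestrict N fun x => hMN ⟨x, rfl⟩, hN,
    fun x y h => hi' (congrArg Subtype.val h)⟩

/-- Over an artin algebra, `inducedHom Inj IsCosyzygy` is the homomorphism `[M] ↦ [Ω⁻¹ M]`. -/
theorem isInduced_inducedHom_cosyzygy (R : Type v) [CommRing R] [IsArtinianRing R] [Algebra R Λ]
    [Module.Finite R Λ] : IsInduced Inj (IsCosyzygy (Λ := Λ)) (inducedHom Inj IsCosyzygy) := by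
  have h := (existsUnique_isInduced_cosyzygy (Λ := Λ) R).exists
  rw [inducedHom, dif_pos h]
  exact h.choose_spec

end EnoughInjectives

end

end IgusaTodorov

/-!
Since `A` is a strong idempotent ideal, extensions between `Λ/A`-modules are the same over `Λ`.
Hence the reflection `M ↦ M / A M` turns the iterated `Λ`-syzygies of a `Λ/A`-module `X` into
`Λ/A`-syzygies, and induces a map `t` of stable groups with `t (Ω^s [X]) = Ω^s [X]` for all `s`.
In the other direction, if `Λ/A` has projective dimension at most `n` over `Λ`, then so has every
projective `Λ/A`-module. Therefore `i [X] = Ω^n [X]` is well defined on the stable group of `Λ/A`,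
and it commutes with `Ω` because `Ω^n [Y] = Ω^(n+1) [X]` for every `Λ/A`-syzygy `Y` of `X`.

An element `x` of `⟨add X⟩` over `Λ/A` now has a counterpart `y` over `Λ` with `t (Ω^s y) = Ω^s x`
and `i (Ω^s x) = Ω^(n+s) y`. If `Ω^(s+1) x = 0`, then `Ω^(n+s+1) y = 0`, so `Ω^s y = 0` as soon as
`Ω` is stably injective from `s` on over `Λ`, and then `Ω^s x = 0`.

For cosyzygies the coreflection `{x ∈ M | A x = 0}` replaces the reflection, and injective
dimensions are bounded through the character module of the right module `Λ/A`: every injective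
`Λ/A`-module is a retract of the character module of a direct sum of copies of it.
-/

namespace IgusaTodorov

noncomputable section

section StableGroup

variable {Λ : Type u} [Ring Λ] {Null : FGModuleCat.{u} Λ → Prop}

/-- The homomorphism out of the stable group given by a function on modules that is additive on
direct sums and vanishes on the null class. -/
def stableLift {G : Type*} [AddCommGroup G] (F : FGModuleCat.{u} Λ → G)
    (hsum : ∀ A B C : FGModuleCat.{u} Λ, (C ≃ₗ[Λ] (A × B)) → F C = F A + F B)
    (hnull : ∀ Z, Null Z → F Z = 0) : StableK Null →+ G :=
  QuotientAddGroup.lift _ (FreeAbelianGroup.lift F) <| by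
    rw [AddSubgroup.closure_le]
    rintro _ (⟨A, B, C, e⟩ | ⟨Z, hZ⟩)
    · simp [AddMonoidHom.mem_ker, hsum A B C e]
    · simp [AddMonoidHom.mem_ker, hnull Z hZ]

lemma stableLift_cls {G : Type*} [AddCommGroup G] (F : FGModuleCat.{u} Λ → G)
    (hsum : ∀ A B C : FGModuleCat.{u} Λ, (C ≃ₗ[Λ] (A × B)) → F C = F A + F B)
    (hnull : ∀ Z, Null Z → F Z = 0) (M : FGModuleCat.{u} Λ) :
    stableLift F hsum hnull (cls Null M) = F M :=
  (QuotientAddGroup.lift_mk _ _ _).trans (FreeAbelianGroup.lift_apply_of _ _)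

lemma stableK_addMonoidHom_ext {G : Type*} [AddCommGroup G] {f g : StableK Null →+ G}
    (h : ∀ M, f (cls Null M) = g (cls Null M)) : f = g :=
  QuotientAddGroup.addMonoidHom_ext _ (FreeAbelianGroup.lift_ext _ _ h)

lemma cls_punit : cls Null (FGModuleCat.of Λ PUnit.{u + 1}) = 0 :=
  left_eq_add.1 (cls_sum (Null := Null) (A := FGModuleCat.of Λ PUnit.{u + 1})
    (B := FGModuleCat.of Λ PUnit.{u + 1}) LinearEquiv.prodUnique.symm)

lemma cls_congr {M N : FGModuleCat.{u} Λ} (e : M ≃ₗ[Λ] N) : cls Null M = cls Null N := by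
  rw [cls_sum (B := FGModuleCat.of Λ PUnit.{u + 1}) (e.trans LinearEquiv.prodUnique.symm),
    cls_punit, add_zero]

lemma cls_prod_of_null (M : FGModuleCat.{u} Λ) {Z : FGModuleCat.{u} Λ} (hZ : Null Z) :
    cls Null (FGModuleCat.of Λ (M × Z)) = cls Null M := by
  rw [cls_sum (A := M) (B := Z) (C := FGModuleCat.of Λ (M × Z)) (LinearEquiv.refl Λ (M × Z)),
    cls_null hZ, add_zero]

lemma isInduced_inducedHom {Syz : FGModuleCat.{u} Λ → FGModuleCat.{u} Λ → Prop}
    (h : ∃ ω, IsInduced Null Syz ω) : IsInduced Null Syz (inducedHom Null Syz) := by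
  rw [inducedHom, dif_pos h]
  exact h.choose_spec

lemma IsInduced.map_iterate_cls {Γ : Type u} [Ring Γ] {Null' : FGModuleCat.{u} Γ → Prop}
    {Syz : FGModuleCat.{u} Λ → FGModuleCat.{u} Λ → Prop}
    {Syz' : FGModuleCat.{u} Γ → FGModuleCat.{u} Γ → Prop}
    {ω : StableK Null →+ StableK Null} {ω' : StableK Null' →+ StableK Null'}
    (hω : IsInduced Null Syz ω) (hω' : IsInduced Null' Syz' ω')
    {t : StableK Null →+ StableK Null'} {T : FGModuleCat.{u} Λ → FGModuleCat.{u} Γ}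
    (ht : ∀ M, t (cls Null M) = cls Null' (T M)) {C : FGModuleCat.{u} Λ → Prop}
    (hC : ∀ M, C M → ∃ N, Syz M N ∧ C N ∧ Syz' (T M) (T N)) (s : ℕ) {M : FGModuleCat.{u} Λ}
    (hM : C M) : t (ω^[s] (cls Null M)) = ω'^[s] (cls Null' (T M)) := by
  induction s generalizing M with
  | zero => exact ht M
  | succ s ih =>
    obtain ⟨N, hMN, hN, hTMN⟩ := hC M hM
    rw [Function.iterate_succ_apply, Function.iterate_succ_apply, hω M N hMN, ih hN,
      hω' _ _ hTMN]

end StableGroup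

section StabIndex

variable {K K' : Type*} [AddCommGroup K] [AddCommGroup K'] {ω : K →+ K} {ω' : K' →+ K'}
  {H : AddSubgroup K} {H' : AddSubgroup K'}

lemma bijOn_image_iterate_iff {s : ℕ} :
    Set.BijOn ω (ω^[s] '' (H : Set K)) (ω^[s + 1] '' (H : Set K)) ↔
      ∀ x ∈ H, ω^[s + 1] x = 0 → ω^[s] x = 0 := by
  have himage : ω '' (ω^[s] '' (H : Set K)) = ω^[s + 1] '' (H : Set K) := by
    rw [Function.iterate_succ', Set.image_comp]
  rw [← himage]
  refine ⟨fun h x hx h0 => h.injOn ⟨x, hx, rfl⟩ ⟨0, H.zero_mem, iterate_map_zero ω s⟩ ?_,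
    fun h => Set.InjOn.bijOn_image ?_⟩
  · rwa [map_zero, ← Function.iterate_succ_apply' ω]
  · rintro _ ⟨x, hx, rfl⟩ _ ⟨y, hy, rfl⟩ hxy
    rw [← Function.iterate_succ_apply' ω, ← Function.iterate_succ_apply' ω, ← sub_eq_zero,
      ← iterate_map_sub] at hxy
    rw [← sub_eq_zero, ← iterate_map_sub]
    exact h (x - y) (H.sub_mem hx hy) hxy

lemma iterate_eq_zero_of_bijOn {n s : ℕ} (hns : n ≤ s)
    (hω : ∀ r, n ≤ r → Set.BijOn ω (ω^[r] '' (H : Set K)) (ω^[r + 1] '' (H : Set K)))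
    {x : K} (hx : x ∈ H) (k : ℕ) (h : ω^[s + k] x = 0) : ω^[s] x = 0 := by
  induction k with
  | zero => exact h
  | succ k ih => exact ih (bijOn_image_iterate_iff.1 (hω (s + k) (by omega)) x hx h)

lemma stabIndex_le_stabIndex (t : K →+ K') (i : K' →+ K) (n : ℕ)
    (h : ∀ x ∈ H', ∃ y ∈ H, ∀ s, t (ω^[s] y) = ω'^[s] x ∧ i (ω'^[s] x) = ω^[n + s] y) :
    stabIndex ω' H' ≤ stabIndex ω H := by
  refine le_iInf₂ fun m hm => iInf₂_le m fun s hs => bijOn_image_iterate_iff.2 fun x hx hsx => ?_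
  obtain ⟨y, hy, hxy⟩ := h x hx
  have hns : ω^[s + (n + 1)] y = 0 := by
    rw [show s + (n + 1) = n + (s + 1) by omega, ← (hxy (s + 1)).2, hsx, map_zero]
  rw [← (hxy s).1, iterate_eq_zero_of_bijOn hs hm hy _ hns, map_zero]

end StabIndex

section Inflate

variable {Λ : Type u} [Ring Λ] {A : Ideal Λ} [A.IsTwoSided]

/-- A `Λ/A`-linear map, viewed as a `Λ`-linear map. -/
def inflateHom {X Y : FGModuleCat.{u} (Λ ⧸ A)} (f : X →ₗ[Λ ⧸ A] Y) : inflate X →ₗ[Λ] inflate Y :=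
  ((incl A).map (ModuleCat.ofHom f)).hom

/-- A `Λ`-linear map between `Λ/A`-modules, viewed as a `Λ/A`-linear map. -/
def deflateHom {X Y : ModuleCat.{u} (Λ ⧸ A)} (f : (incl A).obj X →ₗ[Λ] (incl A).obj Y) :
    X →ₗ[Λ ⧸ A] Y where
  toFun x := f x
  map_add' := f.map_add
  map_smul' b x := by
    obtain ⟨a, rfl⟩ := Ideal.Quotient.mk_surjective b
    exact f.map_smul a x

/-- A `Λ/A`-linear equivalence onto a product, viewed as a `Λ`-linear equivalence. -/
def inflateProdEquiv {X Y Z : FGModuleCat.{u} (Λ ⧸ A)} (e : Z ≃ₗ[Λ ⧸ A] (X × Y)) :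
    inflate Z ≃ₗ[Λ] (inflate X × inflate Y) where
  toFun := e
  invFun := e.symm
  map_add' := e.map_add
  map_smul' a := e.map_smul (Ideal.Quotient.mk A a)
  left_inv := e.left_inv
  right_inv := e.right_inv

lemma smul_eq_zero_of_mem {X : ModuleCat.{u} (Λ ⧸ A)} {a : Λ} (ha : a ∈ A) (x : (incl A).obj X) :
    a • x = 0 := by
  have h : Ideal.Quotient.mk A a • (show X from x) = 0 := by
    rw [Ideal.Quotient.eq_zero_iff_mem.2 ha, zero_smul]
  exact h

lemma IsSummand.inflate {X Y : FGModuleCat.{u} (Λ ⧸ A)} (h : IsSummand X Y) :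
    IsSummand (inflate X) (inflate Y) := by
  obtain ⟨L, ⟨e⟩⟩ := h
  exact ⟨IgusaTodorov.inflate L, ⟨inflateProdEquiv e⟩⟩

/-- A submodule of an inflated module, viewed as a `Λ/A`-submodule. -/
def deflateSubmodule {X : FGModuleCat.{u} (Λ ⧸ A)} (p : Submodule Λ (inflate X)) :
    Submodule (Λ ⧸ A) X where
  carrier := {x | (show inflate X from x) ∈ p}
  add_mem' := p.add_mem
  zero_mem' := p.zero_mem
  smul_mem' b x hx := by
    obtain ⟨a, rfl⟩ := Ideal.Quotient.mk_surjective b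
    exact p.smul_mem a hx

lemma IsIndecomposable.inflate {X : FGModuleCat.{u} (Λ ⧸ A)} (h : IsIndecomposable X) :
    IsIndecomposable (inflate X) := by
  refine ⟨h.1, fun p q hpq => ?_⟩
  have hc : IsCompl (deflateSubmodule p) (deflateSubmodule q) := by
    constructor
    · have h0 := Submodule.disjoint_def.1 hpq.disjoint
      exact Submodule.disjoint_def.2 h0
    · have h1 := Submodule.codisjoint_iff_exists_add_eq.1 hpq.codisjoint
      exact Submodule.codisjoint_iff_exists_add_eq.2 h1
  have hbot {p : Submodule Λ (IgusaTodorov.inflate X)} (h0 : deflateSubmodule p = ⊥) : p = ⊥ :=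
    p.eq_bot_iff.2 ((deflateSubmodule p).eq_bot_iff.1 h0)
  exact (h.2 _ _ hc).imp hbot hbot

/-- The hypotheses `hnull` and `hsyz` say that `[X] ↦ ω^[n] [inflate X]` is a homomorphism of stable
groups intertwining `ω'` with `ω`; it plays the role of a section of `t` up to the delay `n`. -/
lemma stabIndex_addSpan_le_inflate {Null : FGModuleCat.{u} Λ → Prop}
    {Null' : FGModuleCat.{u} (Λ ⧸ A) → Prop}
    {Syz' : FGModuleCat.{u} (Λ ⧸ A) → FGModuleCat.{u} (Λ ⧸ A) → Prop}
    {ω : StableK Null →+ StableK Null} {ω' : StableK Null' →+ StableK Null'}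
    (hω' : IsInduced Null' Syz' ω') (n : ℕ) (t : StableK Null →+ StableK Null')
    (ht : ∀ X s, t (ω^[s] (cls Null (inflate X))) = ω'^[s] (cls Null' X))
    (hnull : ∀ Z, Null' Z → ω^[n] (cls Null (inflate Z)) = 0)
    (hsyz : ∀ X, ∃ Y, Syz' X Y ∧
      ω^[n] (cls Null (inflate Y)) = ω^[n + 1] (cls Null (inflate X)))
    (X : FGModuleCat.{u} (Λ ⧸ A)) :
    stabIndex ω' (addSpan Null' X) ≤ stabIndex ω (addSpan Null (inflate X)) := by
  let i : StableK Null' →+ StableK Null := stableLift (fun X => ω^[n] (cls Null (inflate X)))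
    (fun X Y Z e => by rw [cls_sum (inflateProdEquiv e), iterate_map_add]) hnull
  have hi (X) : i (cls Null' X) = ω^[n] (cls Null (inflate X)) := stableLift_cls _ _ _ X
  have hcomm (x) : i (ω' x) = ω (i x) := by
    refine DFunLike.congr_fun (stableK_addMonoidHom_ext (f := i.comp ω') (g := ω.comp i)
      fun X => ?_) x
    obtain ⟨Y, hXY, h⟩ := hsyz X
    simp only [AddMonoidHom.comp_apply, hω' X Y hXY, hi, h, Function.iterate_succ_apply']
  have hiter (s : ℕ) (x) : i (ω'^[s] x) = ω^[s] (i x) :=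
    Function.Semiconj.iterate_right (f := i) hcomm s x
  refine stabIndex_le_stabIndex t i n fun x hx => ?_
  induction hx using AddSubgroup.closure_induction with
  | mem _ hx =>
    obtain ⟨Y, hY, hYX, rfl⟩ := hx
    refine ⟨cls Null (inflate Y), AddSubgroup.subset_closure ⟨_, hY.inflate, hYX.inflate, rfl⟩,
      fun s => ⟨ht Y s, ?_⟩⟩
    rw [hiter, hi, ← Function.iterate_add_apply, add_comm]
  | zero => exact ⟨0, zero_mem _, fun s => by simp only [iterate_map_zero, map_zero, and_self]⟩
  | add x y _ _ hx hy =>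
    obtain ⟨x', hx', hxs⟩ := hx
    obtain ⟨y', hy', hys⟩ := hy
    refine ⟨x' + y', add_mem hx' hy', fun s => ?_⟩
    simp only [iterate_map_add, map_add, (hxs s).1, (hys s).1, (hxs s).2, (hys s).2, and_self]
  | neg x _ hx =>
    obtain ⟨x', hx', hxs⟩ := hx
    refine ⟨-x', neg_mem hx', fun s => ?_⟩
    simp only [iterate_map_neg, map_neg, (hxs s).1, (hxs s).2, and_self]

end Inflate

section Extension

variable {Λ : Type u} [Ring Λ]

/-- `E` is an extension of `M` by `L`: there is an exact sequence `0 → L → E → M → 0`. -/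
def IsExtension (L E M : FGModuleCat.{u} Λ) : Prop :=
  ∃ (f : L →ₗ[Λ] E) (g : E →ₗ[Λ] M),
    Function.Injective f ∧ Function.Exact f g ∧ Function.Surjective g

lemma IsExtension.isSyzygy {N P M : FGModuleCat.{u} Λ} (h : IsExtension N P M) (hP : Proj P) :
    IsSyzygy M N := by
  obtain ⟨f, g, h⟩ := h
  exact ⟨P, f, g, hP, h⟩

lemma IsExtension.isCosyzygy {M I N : FGModuleCat.{u} Λ} (h : IsExtension M I N) (hI : Inj I) :
    IsCosyzygy M N := by
  obtain ⟨f, g, h⟩ := h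
  exact ⟨I, f, g, hI, h⟩

lemma isExtension_ker [IsNoetherianRing Λ] {E M : FGModuleCat.{u} Λ} {g : E →ₗ[Λ] M}
    (hg : Function.Surjective g) : IsExtension (FGModuleCat.of Λ g.ker) E M :=
  ⟨g.ker.subtype, g, g.ker.injective_subtype, LinearMap.exact_subtype_ker_map g, hg⟩

lemma isExtension_coker {L E : FGModuleCat.{u} Λ} {f : L →ₗ[Λ] E}
    (hf : Function.Injective f) : IsExtension L E (FGModuleCat.of Λ (E ⧸ f.range)) :=
  ⟨f, f.range.mkQ, hf, LinearMap.exact_map_mkQ_range f, f.range.mkQ_surjective⟩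

lemma isExtension_inl_snd (L M : FGModuleCat.{u} Λ) :
    IsExtension L (FGModuleCat.of Λ (L × M)) M :=
  ⟨LinearMap.inl Λ L M, LinearMap.snd Λ L M, LinearMap.inl_injective, .inl_snd,
    LinearMap.snd_surjective⟩

lemma exists_proj_surjective (M : FGModuleCat.{u} Λ) :
    ∃ (P : FGModuleCat.{u} Λ) (p : P →ₗ[Λ] M), Proj P ∧ Function.Surjective p := by
  obtain ⟨n, p, hp⟩ := Module.Finite.exists_fin' Λ M
  exact ⟨FGModuleCat.of Λ (Fin n → Λ), p, inferInstanceAs (Module.Projective Λ (Fin n → Λ)), hp⟩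

lemma exists_isSyzygy [IsNoetherianRing Λ] (M : FGModuleCat.{u} Λ) :
    ∃ N : FGModuleCat.{u} Λ, IsSyzygy M N := by
  obtain ⟨P, p, hP, hp⟩ := exists_proj_surjective M
  exact ⟨_, (isExtension_ker hp).isSyzygy hP⟩

variable (Λ) in
/-- The category of finitely generated `Λ`-modules has enough injectives. -/
def HasEnoughFGInjectives : Prop :=
  ∀ M : FGModuleCat.{u} Λ, ∃ (I : FGModuleCat.{u} Λ) (f : M →ₗ[Λ] I), Inj I ∧ Function.Injective f

lemma HasEnoughFGInjectives.exists_isCosyzygy (h : HasEnoughFGInjectives.{u} Λ)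
    (M : FGModuleCat.{u} Λ) : ∃ N : FGModuleCat.{u} Λ, IsCosyzygy M N := by
  obtain ⟨I, j, hI, hj⟩ := h M
  exact ⟨_, (isExtension_coker hj).isCosyzygy hI⟩

/-- The pullback of `E` along a surjection from a projective module `P` to `M` splits as `L × P`. -/
lemma IsExtension.exists_isSyzygy_isExtension [IsNoetherianRing Λ] {L E M : FGModuleCat.{u} Λ}
    (h : IsExtension L E M) : ∃ P N : FGModuleCat.{u} Λ, Proj P ∧ IsSyzygy M N ∧
      IsExtension N (FGModuleCat.of Λ (L × P)) E := by
  obtain ⟨f, g, hf, hfg, hg⟩ := h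
  obtain ⟨P, p, hP, hp⟩ := exists_proj_surjective M
  have : Module.Projective Λ P := hP
  obtain ⟨r, hr⟩ := Module.projective_lifting_property g p hg
  have hgr (y : P) : g (r y) = p y := LinearMap.congr_fun hr y
  have hgf (x : L) : g (f x) = 0 := hfg.apply_apply_eq_zero x
  let c : (L × P) →ₗ[Λ] E := f.coprod r
  have hc : Function.Surjective c := fun e => by
    obtain ⟨y, hy⟩ := hp (g e)
    obtain ⟨x, hx⟩ := (hfg (e - r y)).1 (by rw [map_sub, hgr, hy, sub_self])
    exact ⟨(x, y), by rw [LinearMap.coprod_apply, hx, sub_add_cancel]⟩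
  refine ⟨P, FGModuleCat.of Λ c.ker, hP,
    ⟨P, LinearMap.snd Λ L P ∘ₗ c.ker.subtype, p, hP, ?_, ?_, hp⟩,
    isExtension_ker (E := FGModuleCat.of Λ (L × P)) hc⟩
  · rw [← LinearMap.ker_eq_bot, LinearMap.ker_eq_bot']
    rintro ⟨⟨x, y⟩, hxy⟩ (rfl : y = 0)
    have hx : f x = f 0 := by simpa [c] using hxy
    simp [hf hx]
  · intro y
    constructor
    · intro hy
      obtain ⟨x, hx⟩ := (hfg (-r y)).1 (by rw [map_neg, hgr, hy, neg_zero])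
      exact ⟨⟨(x, y), by rw [LinearMap.mem_ker, LinearMap.coprod_apply, hx, neg_add_cancel]⟩, rfl⟩
    · rintro ⟨⟨⟨x, y⟩, hxy⟩, rfl⟩
      have := congrArg g (LinearMap.mem_ker.1 hxy)
      rwa [LinearMap.coprod_apply, map_add, hgf, hgr, zero_add, map_zero] at this

/-- The pushout of `E` along an embedding of `L` into an injective module `I` splits as `M × I`. -/
lemma IsExtension.exists_isCosyzygy_isExtension (hΛ : HasEnoughFGInjectives.{u} Λ)
    {L E M : FGModuleCat.{u} Λ} (h : IsExtension L E M) : ∃ I N : FGModuleCat.{u} Λ, Inj I ∧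
      IsCosyzygy L N ∧ IsExtension E (FGModuleCat.of Λ (M × I)) N := by
  obtain ⟨f, g, hf, hfg, hg⟩ := h
  obtain ⟨I, j, hI, hj⟩ := hΛ L
  have : Module.Injective Λ I := hI
  obtain ⟨r, hr⟩ := Module.Injective.extension_property Λ _ _ _ f hf j
  have hrf (x : L) : r (f x) = j x := LinearMap.congr_fun hr x
  have hgf (x : L) : g (f x) = 0 := hfg.apply_apply_eq_zero x
  let c : E →ₗ[Λ] M × I := g.prod r
  have hc : Function.Injective c := by
    rw [← LinearMap.ker_eq_bot, LinearMap.ker_eq_bot']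
    intro e he
    obtain ⟨x, rfl⟩ := (hfg e).1 (congrArg Prod.fst he)
    have hx : j x = j 0 := by rw [← hrf, map_zero]; exact congrArg Prod.snd he
    rw [hj hx, map_zero]
  refine ⟨I, FGModuleCat.of Λ ((M × I) ⧸ c.range), hI,
    ⟨I, j, c.range.mkQ ∘ₗ LinearMap.inr Λ M I, hI, hj, ?_, ?_⟩,
    isExtension_coker (E := FGModuleCat.of Λ (M × I)) hc⟩
  · intro y
    rw [LinearMap.comp_apply, Submodule.mkQ_apply, Submodule.Quotient.mk_eq_zero]
    constructor
    · rintro ⟨e, he⟩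
      obtain ⟨x, rfl⟩ := (hfg e).1 (congrArg Prod.fst he)
      exact ⟨x, by rw [← hrf]; exact congrArg Prod.snd he⟩
    · rintro ⟨x, rfl⟩
      exact ⟨f x, Prod.ext (hgf x) (hrf x)⟩
  · intro q
    obtain ⟨⟨m, y⟩, rfl⟩ := c.range.mkQ_surjective q
    obtain ⟨e, rfl⟩ := hg m
    refine ⟨y - r e, (Submodule.Quotient.eq _).2 ⟨-e, ?_⟩⟩
    ext <;> simp [c]

end Extension

section Dimension

variable {Λ : Type u} [Ring Λ]

lemma proj_iff_hasProjectiveDimensionLT_one (P : FGModuleCat.{u} Λ) :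
    Proj P ↔ HasProjectiveDimensionLT P.obj 1 :=
  (IsProjective.iff_projective (R := Λ) P).trans projective_iff_hasProjectiveDimensionLT_one

lemma inj_iff_hasInjectiveDimensionLT_one (I : FGModuleCat.{u} Λ) :
    Inj I ↔ HasInjectiveDimensionLT I.obj 1 :=
  (Module.injective_iff_injective_object Λ I).trans injective_iff_hasInjectiveDimensionLT_one

lemma Proj.hasProjectiveDimensionLT {P : FGModuleCat.{u} Λ} (hP : Proj P) (n : ℕ) :
    HasProjectiveDimensionLT P.obj (n + 1) :=
  have := (proj_iff_hasProjectiveDimensionLT_one P).1 hP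
  hasProjectiveDimensionLT_of_ge P.obj 1 (n + 1) (by omega)

lemma Inj.hasInjectiveDimensionLT {I : FGModuleCat.{u} Λ} (hI : Inj I) (n : ℕ) :
    HasInjectiveDimensionLT I.obj (n + 1) :=
  have := (inj_iff_hasInjectiveDimensionLT_one I).1 hI
  hasInjectiveDimensionLT_of_ge I.obj 1 (n + 1) (by omega)

lemma shortExact_moduleCatMk {L E M : Type u} [AddCommGroup L] [AddCommGroup E] [AddCommGroup M]
    [Module Λ L] [Module Λ E] [Module Λ M] {f : L →ₗ[Λ] E} {g : E →ₗ[Λ] M}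
    (hf : Function.Injective f) (hfg : Function.Exact f g) (hg : Function.Surjective g) :
    (ShortComplex.moduleCatMk f g hfg.linearMap_comp_eq_zero).ShortExact :=
  ModuleCat.shortComplex_shortExact _ hfg hf hg

lemma IsExtension.exists_shortExact {L E M : FGModuleCat.{u} Λ} (h : IsExtension L E M) :
    ∃ (f : L.obj ⟶ E.obj) (g : E.obj ⟶ M.obj) (w : f ≫ g = 0),
      (ShortComplex.mk f g w).ShortExact := by
  obtain ⟨f, g, hf, hfg, hg⟩ := h
  exact ⟨_, _, _, shortExact_moduleCatMk hf hfg hg⟩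

lemma hasProjectiveDimensionLT_prod {L M : FGModuleCat.{u} Λ} {n : ℕ}
    (hL : HasProjectiveDimensionLT L.obj n) (hM : HasProjectiveDimensionLT M.obj n) :
    HasProjectiveDimensionLT (FGModuleCat.of Λ (L × M)).obj n := by
  obtain ⟨_, _, _, h⟩ := (isExtension_inl_snd L M).exists_shortExact
  exact h.hasProjectiveDimensionLT_X₂ n hL hM

lemma hasInjectiveDimensionLT_prod {L M : FGModuleCat.{u} Λ} {n : ℕ}
    (hL : HasInjectiveDimensionLT L.obj n) (hM : HasInjectiveDimensionLT M.obj n) :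
    HasInjectiveDimensionLT (FGModuleCat.of Λ (L × M)).obj n := by
  obtain ⟨_, _, _, h⟩ := (isExtension_inl_snd L M).exists_shortExact
  exact h.hasInjectiveDimensionLT_X₂ n hL hM

lemma IsSyzygy.hasProjectiveDimensionLT {M N : FGModuleCat.{u} Λ} (h : IsSyzygy M N) {n : ℕ}
    (hM : HasProjectiveDimensionLT M.obj (n + 2)) : HasProjectiveDimensionLT N.obj (n + 1) := by
  obtain ⟨P, f, g, hP, hf, hfg, hg⟩ := h
  exact (shortExact_moduleCatMk hf hfg hg).hasProjectiveDimensionLT_X₁ _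
    (hP.hasProjectiveDimensionLT n) hM

lemma IsCosyzygy.hasInjectiveDimensionLT {M N : FGModuleCat.{u} Λ} (h : IsCosyzygy M N) {n : ℕ}
    (hM : HasInjectiveDimensionLT M.obj (n + 2)) : HasInjectiveDimensionLT N.obj (n + 1) := by
  obtain ⟨I, f, g, hI, hf, hfg, hg⟩ := h
  exact (shortExact_moduleCatMk hf hfg hg).hasInjectiveDimensionLT_X₃ _
    (hI.hasInjectiveDimensionLT n) hM

lemma isExtension_self_zero (M : FGModuleCat.{u} Λ) :
    IsExtension M M (FGModuleCat.of Λ PUnit.{u + 1}) :=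
  ⟨LinearMap.id, 0, Function.injective_id, fun x => ⟨fun _ => ⟨x, rfl⟩, fun _ => rfl⟩,
    fun _ => ⟨0, rfl⟩⟩

lemma isExtension_zero_self (M : FGModuleCat.{u} Λ) :
    IsExtension (FGModuleCat.of Λ PUnit.{u + 1}) M M :=
  ⟨0, LinearMap.id, Function.injective_of_subsingleton _,
    fun _ => ⟨fun hx => ⟨0, hx.symm⟩, fun ⟨_, hx⟩ => hx.symm⟩, Function.surjective_id⟩

/-- Three successive syzygies rotate an extension `0 → L → E → M → 0` into one of `Ω M` by `Ω L`
with middle term `Ω E`, up to projective summands. -/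
lemma IsInduced.iterate_succ_cls_of_isExtension [IsNoetherianRing Λ]
    {ω : StableK (Proj (Λ := Λ)) →+ StableK (Proj (Λ := Λ))} (hω : IsInduced Proj IsSyzygy ω)
    {n : ℕ} {L E M : FGModuleCat.{u} Λ} (h : IsExtension L E M)
    (hE : HasProjectiveDimensionLT E.obj (n + 1)) :
    ω^[n + 1] (cls Proj M) = ω^[n] (cls Proj L) := by
  induction n generalizing L E M with
  | zero => exact hω M L (h.isSyzygy ((proj_iff_hasProjectiveDimensionLT_one E).2 hE))
  | succ n ih =>
    obtain ⟨P, M', hP, hM', h₁⟩ := h.exists_isSyzygy_isExtension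
    obtain ⟨Q, E', hQ, hE', h₂⟩ := h₁.exists_isSyzygy_isExtension
    obtain ⟨S, L', hS, hL', h₃⟩ := h₂.exists_isSyzygy_isExtension
    have hE'S := hasProjectiveDimensionLT_prod (hE'.hasProjectiveDimensionLT hE)
      (hS.hasProjectiveDimensionLT n)
    have hML := ih h₃ hE'S
    rwa [cls_prod_of_null M' hQ, ← hω _ _ hM', ← hω _ _ hL', cls_prod_of_null L hP,
      ← Function.iterate_succ_apply ω, ← Function.iterate_succ_apply ω] at hML

lemma IsInduced.iterate_cls_eq_zero [IsNoetherianRing Λ]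
    {ω : StableK (Proj (Λ := Λ)) →+ StableK (Proj (Λ := Λ))} (hω : IsInduced Proj IsSyzygy ω)
    {n : ℕ} {M : FGModuleCat.{u} Λ} (hM : HasProjectiveDimensionLT M.obj (n + 1)) :
    ω^[n] (cls Proj M) = 0 := by
  rw [← hω.iterate_succ_cls_of_isExtension (isExtension_self_zero M) hM,
    cls_punit, iterate_map_zero]

lemma IsInduced.iterate_succ_cls_of_isExtension_cosyzygy (hΛ : HasEnoughFGInjectives.{u} Λ)
    {ω : StableK (Inj (Λ := Λ)) →+ StableK (Inj (Λ := Λ))} (hω : IsInduced Inj IsCosyzygy ω)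
    {n : ℕ} {L E M : FGModuleCat.{u} Λ} (h : IsExtension L E M)
    (hE : HasInjectiveDimensionLT E.obj (n + 1)) :
    ω^[n + 1] (cls Inj L) = ω^[n] (cls Inj M) := by
  induction n generalizing L E M with
  | zero => exact hω L M (h.isCosyzygy ((inj_iff_hasInjectiveDimensionLT_one E).2 hE))
  | succ n ih =>
    obtain ⟨I, L', hI, hL', h₁⟩ := h.exists_isCosyzygy_isExtension hΛ
    obtain ⟨J, E', hJ, hE', h₂⟩ := h₁.exists_isCosyzygy_isExtension hΛ
    obtain ⟨K, M', hK, hM', h₃⟩ := h₂.exists_isCosyzygy_isExtension hΛ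
    have hE'K := hasInjectiveDimensionLT_prod (hE'.hasInjectiveDimensionLT hE)
      (hK.hasInjectiveDimensionLT n)
    have hLM := ih h₃ hE'K
    rwa [cls_prod_of_null L' hJ, ← hω _ _ hL', ← hω _ _ hM', cls_prod_of_null M hI,
      ← Function.iterate_succ_apply ω, ← Function.iterate_succ_apply ω] at hLM

lemma IsInduced.iterate_cls_eq_zero_cosyzygy (hΛ : HasEnoughFGInjectives.{u} Λ)
    {ω : StableK (Inj (Λ := Λ)) →+ StableK (Inj (Λ := Λ))} (hω : IsInduced Inj IsCosyzygy ω)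
    {n : ℕ} {M : FGModuleCat.{u} Λ} (hM : HasInjectiveDimensionLT M.obj (n + 1)) :
    ω^[n] (cls Inj M) = 0 := by
  rw [← hω.iterate_succ_cls_of_isExtension_cosyzygy hΛ (isExtension_zero_self M) hM,
    cls_punit, iterate_map_zero]

end Dimension

section Reflect

variable {Λ : Type u} [Ring Λ] {A : Ideal Λ} [A.IsTwoSided]

variable (A) in
/-- The `Λ/A`-module `M / A M`. -/
def reflect (M : FGModuleCat.{u} Λ) : FGModuleCat.{u} (Λ ⧸ A) :=
  letI := (Module.isTorsionBySet_quotient_ideal_smul M A).module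
  haveI : IsScalarTower Λ (Λ ⧸ A) (M ⧸ A • (⊤ : Submodule Λ M)) :=
    (Module.isTorsionBySet_quotient_ideal_smul M A).isScalarTower
  haveI : Module.Finite (Λ ⧸ A) (M ⧸ A • (⊤ : Submodule Λ M)) :=
    Module.Finite.of_restrictScalars_finite Λ _ _
  FGModuleCat.of (Λ ⧸ A) (M ⧸ A • (⊤ : Submodule Λ M))

variable (A) in
/-- The projection `M → M / A M`, the unit of the adjunction between `reflect` and `inflate`. -/
def reflectMk (M : FGModuleCat.{u} Λ) : M →ₗ[Λ] inflate (reflect A M) where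
  toFun := (A • (⊤ : Submodule Λ M)).mkQ
  map_add' := map_add _
  map_smul' _ _ := rfl

lemma reflectMk_surjective (M : FGModuleCat.{u} Λ) : Function.Surjective (reflectMk A M) :=
  (A • (⊤ : Submodule Λ M)).mkQ_surjective

lemma ker_reflectMk (M : FGModuleCat.{u} Λ) : (reflectMk A M).ker = A • (⊤ : Submodule Λ M) :=
  (A • (⊤ : Submodule Λ M)).ker_mkQ

/-- The `Λ/A`-linear map out of `M / A M` induced by a `Λ`-linear map from `M` to an inflated
module. -/
def reflectLift {M : FGModuleCat.{u} Λ} {Y : FGModuleCat.{u} (Λ ⧸ A)} (f : M →ₗ[Λ] inflate Y) :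
    reflect A M →ₗ[Λ ⧸ A] Y :=
  have hle : A • (⊤ : Submodule Λ M) ≤ f.ker :=
    Submodule.smul_le.2 fun a ha x _ => (f.map_smul a x).trans (smul_eq_zero_of_mem ha (f x))
  deflateHom
    { toFun := (A • (⊤ : Submodule Λ M)).liftQ f hle
      map_add' := map_add _
      map_smul' := ((A • (⊤ : Submodule Λ M)).liftQ f hle).map_smul }

lemma reflect_hom_ext {M : FGModuleCat.{u} Λ} {Y : Type u} [AddCommGroup Y] [Module (Λ ⧸ A) Y]
    {φ ψ : reflect A M →ₗ[Λ ⧸ A] Y} (h : ∀ x, φ (reflectMk A M x) = ψ (reflectMk A M x)) :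
    φ = ψ := by
  ext x
  obtain ⟨x, rfl⟩ := reflectMk_surjective M x
  exact h x

variable (A) in
/-- The map `M / A M → N / A N` induced by a linear map. -/
def reflectMap {M N : FGModuleCat.{u} Λ} (f : M →ₗ[Λ] N) : reflect A M →ₗ[Λ ⧸ A] reflect A N :=
  reflectLift (reflectMk A N ∘ₗ f)

lemma reflectMap_mk {M N : FGModuleCat.{u} Λ} (f : M →ₗ[Λ] N) (x : M) :
    reflectMap A f (reflectMk A M x) = reflectMk A N (f x) := rfl

variable (A) in
/-- The reflection is additive. -/
def reflectProdEquiv {L M N : FGModuleCat.{u} Λ} (e : N ≃ₗ[Λ] (L × M)) :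
    reflect A N ≃ₗ[Λ ⧸ A] (reflect A L × reflect A M) :=
  LinearEquiv.ofLinearMap
    ((reflectMap A (LinearMap.fst Λ L M ∘ₗ e.toLinearMap)).prod
      (reflectMap A (LinearMap.snd Λ L M ∘ₗ e.toLinearMap)))
    ((reflectMap A (e.symm.toLinearMap ∘ₗ LinearMap.inl Λ L M)).coprod
      (reflectMap A (e.symm.toLinearMap ∘ₗ LinearMap.inr Λ L M)))
    (LinearMap.ext fun (x, y) => by
      obtain ⟨x, rfl⟩ := reflectMk_surjective L x
      obtain ⟨y, rfl⟩ := reflectMk_surjective M y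
      have hxy : e (e.symm (x, 0) + e.symm (0, y)) = (x, y) := by simp [← map_add]
      exact congrArg (Prod.map (reflectMk A L) (reflectMk A M)) hxy)
    (reflect_hom_ext fun x => by
      have hx : e.symm ((e x).1, 0) + e.symm (0, (e x).2) = x := by simp [← map_add]
      exact congrArg (reflectMk A N) hx)

lemma Proj.reflect {P : FGModuleCat.{u} Λ} (hP : Proj P) : Proj (reflect A P) := by
  obtain ⟨Q, p, hQ, hp⟩ := exists_proj_surjective (IgusaTodorov.reflect A P)
  have : Module.Projective Λ P := hP
  have : Module.Projective (Λ ⧸ A) Q := hQ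
  obtain ⟨s, hs⟩ := Module.projective_lifting_property (inflateHom p) (reflectMk A P) hp
  exact Module.Projective.of_split (reflectLift s) p
    (reflect_hom_ext fun x => LinearMap.congr_fun hs x)

lemma cls_reflect_inflate {Null : FGModuleCat.{u} (Λ ⧸ A) → Prop} (X : FGModuleCat.{u} (Λ ⧸ A)) :
    cls Null (reflect A (inflate X)) = cls Null X :=
  cls_congr (LinearEquiv.ofLinearMap (reflectLift LinearMap.id)
    (deflateHom (reflectMk A (inflate X))) (LinearMap.ext fun _ => rfl)
    (reflect_hom_ext fun _ => rfl))

lemma reflectMap_surjective {M N : FGModuleCat.{u} Λ} {f : M →ₗ[Λ] N}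
    (hf : Function.Surjective f) : Function.Surjective (reflectMap A f) := fun y => by
  obtain ⟨x, rfl⟩ := reflectMk_surjective N y
  obtain ⟨m, rfl⟩ := hf x
  exact ⟨reflectMk A M m, rfl⟩

lemma exact_reflectMap {L E M : FGModuleCat.{u} Λ} {f : L →ₗ[Λ] E} {g : E →ₗ[Λ] M}
    (hfg : Function.Exact f g) (hg : Function.Surjective g) :
    Function.Exact (reflectMap A f) (reflectMap A g) := by
  intro y
  obtain ⟨e, rfl⟩ := reflectMk_surjective E y
  constructor
  · intro he
    have htop : A • (⊤ : Submodule Λ M) = (A • (⊤ : Submodule Λ E)).map g := by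
      rw [Submodule.map_smul'', Submodule.map_top, LinearMap.range_eq_top.2 hg]
    have hge : g e ∈ (reflectMk A M).ker := he
    rw [ker_reflectMk, htop] at hge
    obtain ⟨z, hz, hze⟩ := hge
    obtain ⟨x, hx⟩ := (hfg (e - z)).1 (by rw [map_sub, hze, sub_self])
    have hz0 : reflectMk A E z = 0 := by rwa [← LinearMap.mem_ker, ker_reflectMk]
    exact ⟨reflectMk A L x, by rw [reflectMap_mk, hx, map_sub, hz0, sub_zero]⟩
  · rintro ⟨z, hz⟩
    obtain ⟨x, rfl⟩ := reflectMk_surjective L z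
    rw [← hz, reflectMap_mk, reflectMap_mk, hfg.apply_apply_eq_zero]
    exact map_zero _

end Reflect

section ReflectSyzygy

variable {Λ : Type u} [Ring Λ] {A : Ideal Λ} [A.IsTwoSided]

variable (A) in
/-- All higher extensions of `M` by injective modules in `mod Λ/A` vanish. -/
def ExtInjVanish (M : FGModuleCat.{u} Λ) : Prop :=
  ∀ I : FGModuleCat.{u} (Λ ⧸ A), Inj I → ∀ (i : ℕ) (e : Abelian.Ext M.obj (inflate I).obj (i + 1)),
    e = 0

lemma IsStrongIdempotent.extInjVanish (hA : IsStrongIdempotent A) (X : FGModuleCat.{u} (Λ ⧸ A)) :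
    ExtInjVanish A (inflate X) := by
  intro I hI i e
  have : Injective I.obj := (Module.injective_iff_injective_object (Λ ⧸ A) I).1 hI
  obtain ⟨e', rfl⟩ := (hA X I (i + 1)).2 e
  rw [Abelian.Ext.eq_zero_of_injective e']
  exact map_zero _

lemma ExtInjVanish.isSyzygy {M N : FGModuleCat.{u} Λ} (hM : ExtInjVanish A M)
    (h : IsSyzygy M N) : ExtInjVanish A N := by
  intro I hI i e
  obtain ⟨P, f, g, hP, hf, hfg, hg⟩ := h
  have hP' : Projective P.obj := (IsProjective.iff_projective (R := Λ) P).1 hP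
  obtain ⟨x, rfl⟩ := Abelian.Ext.contravariant_sequence_exact₁
    (shortExact_moduleCatMk hf hfg hg) (inflate I).obj e (add_comm 1 (i + 1)) (hM I hI _ _)
  have hx : x = 0 := Abelian.Ext.eq_zero_of_projective (P := P.obj) x
  rw [hx, Abelian.Ext.comp_zero]
  rfl

lemma ExtInjVanish.exists_extension {N P M : FGModuleCat.{u} Λ} (hM : ExtInjVanish A M)
    {f : N →ₗ[Λ] P} {g : P →ₗ[Λ] M} (hf : Function.Injective f) (hfg : Function.Exact f g)
    (hg : Function.Surjective g) {I : FGModuleCat.{u} (Λ ⧸ A)} (hI : Inj I)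
    (φ : N →ₗ[Λ] inflate I) : ∃ ψ : P →ₗ[Λ] inflate I, ψ ∘ₗ f = φ := by
  let φ' : N.obj ⟶ (inflate I).obj := ConcreteCategory.ofHom φ
  obtain ⟨x, hx⟩ := Abelian.Ext.contravariant_sequence_exact₁ (shortExact_moduleCatMk hf hfg hg)
    (inflate I).obj (Abelian.Ext.mk₀ φ') (add_comm 1 0) (hM I hI _ _)
  obtain ⟨ψ, rfl⟩ := Abelian.Ext.homEquiv₀.symm.surjective x
  rw [Abelian.Ext.homEquiv₀_symm_apply, Abelian.Ext.mk₀_comp_mk₀] at hx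
  exact ⟨ψ.hom, congrArg ModuleCat.Hom.hom ((Abelian.Ext.mk₀_bijective _ _).1 hx)⟩

/-- A map from `N` to an injective `Λ/A`-module extends along `f`, so `reflectMap A f` is injective
once `N / A N` embeds into an injective `Λ/A`-module. -/
lemma ExtInjVanish.reflectMap_injective (hA : HasEnoughFGInjectives.{u} (Λ ⧸ A))
    {N P M : FGModuleCat.{u} Λ} (hM : ExtInjVanish A M) {f : N →ₗ[Λ] P} {g : P →ₗ[Λ] M}
    (hf : Function.Injective f) (hfg : Function.Exact f g) (hg : Function.Surjective g) :
    Function.Injective (reflectMap A f) := by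
  obtain ⟨I, j, hI, hj⟩ := hA (reflect A N)
  obtain ⟨ψ, hψ⟩ := hM.exists_extension hf hfg hg hI (inflateHom j ∘ₗ reflectMk A N)
  have hψj : reflectLift ψ ∘ₗ reflectMap A f = j :=
    reflect_hom_ext fun x => LinearMap.congr_fun hψ x
  refine Function.Injective.of_comp (f := reflectLift ψ) ?_
  rwa [← LinearMap.coe_comp, hψj]

lemma IsSyzygy.reflect (hA : HasEnoughFGInjectives.{u} (Λ ⧸ A)) {M N : FGModuleCat.{u} Λ}
    (hM : ExtInjVanish A M) (h : IsSyzygy M N) : IsSyzygy (reflect A M) (reflect A N) := by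
  obtain ⟨P, f, g, hP, hf, hfg, hg⟩ := h
  exact ⟨IgusaTodorov.reflect A P, reflectMap A f, reflectMap A g, hP.reflect,
    hM.reflectMap_injective hA hf hfg hg, exact_reflectMap hfg hg, reflectMap_surjective hg⟩

variable (A) in
/-- The homomorphism of stable groups induced by the reflection. -/
def stableReflect : StableK (Proj (Λ := Λ)) →+ StableK (Proj (Λ := Λ ⧸ A)) :=
  stableLift (fun M => cls Proj (reflect A M)) (fun _ _ _ e => cls_sum (reflectProdEquiv A e))
    fun _ hZ => cls_null hZ.reflect

lemma stableReflect_iterate_cls_inflate [IsNoetherianRing Λ] (hA : IsStrongIdempotent A)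
    (hinj : HasEnoughFGInjectives.{u} (Λ ⧸ A))
    {ω : StableK (Proj (Λ := Λ)) →+ StableK (Proj (Λ := Λ))}
    {ω' : StableK (Proj (Λ := Λ ⧸ A)) →+ StableK (Proj (Λ := Λ ⧸ A))}
    (hω : IsInduced Proj IsSyzygy ω) (hω' : IsInduced Proj IsSyzygy ω')
    (X : FGModuleCat.{u} (Λ ⧸ A)) (s : ℕ) :
    stableReflect A (ω^[s] (cls Proj (inflate X))) = ω'^[s] (cls Proj X) := by
  have hsyz (M : FGModuleCat.{u} Λ) (hM : ExtInjVanish A M) :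
      ∃ N, IsSyzygy M N ∧ ExtInjVanish A N ∧ IsSyzygy (reflect A M) (reflect A N) := by
    obtain ⟨N, hN⟩ := exists_isSyzygy M
    exact ⟨N, hN, hM.isSyzygy hN, hN.reflect hinj hM⟩
  rw [hω.map_iterate_cls hω' (t := stableReflect A) (stableLift_cls _ _ _) hsyz s
    (hA.extInjVanish X), cls_reflect_inflate]

end ReflectSyzygy

section Coreflect

variable {Λ : Type u} [Ring Λ] {A : Ideal Λ} [A.IsTwoSided]

variable (A) in
/-- The submodule `{x | A x = 0}` of `M`. -/
def annSubmodule (M : Type u) [AddCommGroup M] [Module Λ M] : Submodule Λ M where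
  carrier := {x | ∀ a ∈ A, a • x = 0}
  add_mem' hx hy a ha := by rw [smul_add, hx a ha, hy a ha, add_zero]
  zero_mem' a _ := smul_zero a
  smul_mem' b x hx a ha := by
    rw [smul_smul]
    exact hx _ (A.mul_mem_right b ha)

lemma isTorsionBySet_annSubmodule (M : Type u) [AddCommGroup M] [Module Λ M] :
    Module.IsTorsionBySet Λ (annSubmodule A M) A :=
  fun x a => Subtype.ext (x.2 a a.2)

variable [IsNoetherianRing Λ]

variable (A) in
/-- The `Λ/A`-module `{x | A x = 0}` of elements of `M`. -/
def coreflect (M : FGModuleCat.{u} Λ) : FGModuleCat.{u} (Λ ⧸ A) :=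
  letI := (isTorsionBySet_annSubmodule (A := A) M).module
  haveI : IsScalarTower Λ (Λ ⧸ A) (annSubmodule A M) :=
    (isTorsionBySet_annSubmodule M).isScalarTower
  haveI : Module.Finite (Λ ⧸ A) (annSubmodule A M) :=
    Module.Finite.of_restrictScalars_finite Λ _ _
  FGModuleCat.of (Λ ⧸ A) (annSubmodule A M)

variable (A) in
/-- The inclusion `{x | A x = 0} → M`, the counit of the adjunction between `inflate` and
`coreflect`. -/
def coreflectIncl (M : FGModuleCat.{u} Λ) : inflate (coreflect A M) →ₗ[Λ] M where
  toFun := (annSubmodule A M).subtype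
  map_add' := map_add _
  map_smul' _ _ := rfl

lemma coreflectIncl_injective (M : FGModuleCat.{u} Λ) : Function.Injective (coreflectIncl A M) :=
  (annSubmodule A M).injective_subtype

lemma exists_coreflectIncl_eq {M : FGModuleCat.{u} Λ} {x : M} (hx : ∀ a ∈ A, a • x = 0) :
    ∃ y, coreflectIncl A M y = x :=
  ⟨(⟨x, hx⟩ : annSubmodule A M), rfl⟩

/-- The `Λ/A`-linear map into `{x | A x = 0}` given by a `Λ`-linear map from a `Λ/A`-module
to `M`. -/
def coreflectLift {Y : ModuleCat.{u} (Λ ⧸ A)} {M : FGModuleCat.{u} Λ}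
    (f : (incl A).obj Y →ₗ[Λ] M) : Y →ₗ[Λ ⧸ A] coreflect A M :=
  have hf (y) : f y ∈ annSubmodule A M := fun a ha => by
    rw [← map_smul, smul_eq_zero_of_mem ha, map_zero]
  deflateHom
    { toFun := f.codRestrict (annSubmodule A M) hf
      map_add' := map_add _
      map_smul' := (f.codRestrict (annSubmodule A M) hf).map_smul }

variable (A) in
/-- The restriction `{x | A x = 0} → {y | A y = 0}` of a linear map. -/
def coreflectMap {M N : FGModuleCat.{u} Λ} (f : M →ₗ[Λ] N) :
    coreflect A M →ₗ[Λ ⧸ A] coreflect A N :=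
  coreflectLift (f ∘ₗ coreflectIncl A M)

variable (A) in
/-- The coreflection is additive. -/
def coreflectProdEquiv {L M N : FGModuleCat.{u} Λ} (e : N ≃ₗ[Λ] (L × M)) :
    coreflect A N ≃ₗ[Λ ⧸ A] (coreflect A L × coreflect A M) :=
  LinearEquiv.ofLinearMap
    ((coreflectMap A (LinearMap.fst Λ L M ∘ₗ e.toLinearMap)).prod
      (coreflectMap A (LinearMap.snd Λ L M ∘ₗ e.toLinearMap)))
    ((coreflectMap A (e.symm.toLinearMap ∘ₗ LinearMap.inl Λ L M)).coprod
      (coreflectMap A (e.symm.toLinearMap ∘ₗ LinearMap.inr Λ L M)))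
    (LinearMap.ext fun (x, y) => by
      have hxy (x : L) (y : M) : e (e.symm (x, 0) + e.symm (0, y)) = (x, y) := by
        simp [← map_add]
      exact (coreflectIncl_injective L).prodMap (coreflectIncl_injective M)
        (hxy (coreflectIncl A L x) (coreflectIncl A M y)))
    (LinearMap.ext fun x => coreflectIncl_injective N (by
      have hx (x : N) : e.symm ((e x).1, 0) + e.symm (0, (e x).2) = x := by simp [← map_add]
      exact hx (coreflectIncl A N x)))

lemma Inj.coreflect {I : FGModuleCat.{u} Λ} (hI : Inj I) : Inj (coreflect A I) := by
  refine ⟨fun X Y _ _ _ _ i hi f => ?_⟩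
  let i' : (incl A).obj (ModuleCat.of (Λ ⧸ A) X) →ₗ[Λ] (incl A).obj (ModuleCat.of (Λ ⧸ A) Y) :=
    ((incl A).map (ModuleCat.ofHom i)).hom
  let f' : (incl A).obj (ModuleCat.of (Λ ⧸ A) X) →ₗ[Λ] inflate (IgusaTodorov.coreflect A I) :=
    ((incl A).map (ModuleCat.ofHom f)).hom
  obtain ⟨h, hh⟩ := hI.out i' hi (coreflectIncl A I ∘ₗ f')
  exact ⟨coreflectLift h, fun x => coreflectIncl_injective I (hh x)⟩

lemma cls_coreflect_inflate {Null : FGModuleCat.{u} (Λ ⧸ A) → Prop} (X : FGModuleCat.{u} (Λ ⧸ A)) :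
    cls Null (coreflect A (inflate X)) = cls Null X :=
  cls_congr (LinearEquiv.ofLinearMap (deflateHom (coreflectIncl A (inflate X)))
    (coreflectLift (M := inflate X) (Y := X.obj) LinearMap.id) (LinearMap.ext fun _ => rfl)
    (LinearMap.ext fun _ => rfl))

lemma coreflectMap_injective {M N : FGModuleCat.{u} Λ} {f : M →ₗ[Λ] N}
    (hf : Function.Injective f) : Function.Injective (coreflectMap A f) := fun _ _ h =>
  coreflectIncl_injective M (hf (congrArg (coreflectIncl A N) h))

lemma exact_coreflectMap {L E M : FGModuleCat.{u} Λ} {f : L →ₗ[Λ] E} {g : E →ₗ[Λ] M}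
    (hf : Function.Injective f) (hfg : Function.Exact f g) :
    Function.Exact (coreflectMap A f) (coreflectMap A g) := by
  intro y
  constructor
  · intro hy
    obtain ⟨x, hx⟩ := (hfg (coreflectIncl A E y)).1 (congrArg (coreflectIncl A M) hy)
    have hAx (a : Λ) (ha : a ∈ A) : a • x = 0 := hf (by
      rw [map_smul, hx, map_zero]
      exact (show annSubmodule A E from y).2 a ha)
    obtain ⟨x, rfl⟩ := exists_coreflectIncl_eq hAx
    exact ⟨x, coreflectIncl_injective E hx⟩
  · rintro ⟨x, rfl⟩
    exact coreflectIncl_injective M (hfg.apply_apply_eq_zero (coreflectIncl A L x))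

lemma HasEnoughFGInjectives.quotient (h : HasEnoughFGInjectives.{u} Λ) :
    HasEnoughFGInjectives.{u} (Λ ⧸ A) := fun X => by
  obtain ⟨I, j, hI, hj⟩ := h (inflate X)
  exact ⟨coreflect A I, coreflectLift (Y := X.obj) j, hI.coreflect,
    fun _ _ hxy => hj (congrArg (coreflectIncl A I) hxy)⟩

end Coreflect

section CoreflectCosyzygy

variable {Λ : Type u} [Ring Λ] {A : Ideal Λ} [A.IsTwoSided]

variable (A) in
/-- All higher extensions of `Λ/A` by `M` vanish. -/
def ExtQuotVanish (M : FGModuleCat.{u} Λ) : Prop :=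
  ∀ (i : ℕ) (e : Abelian.Ext (inflate (FGModuleCat.of (Λ ⧸ A) (Λ ⧸ A))).obj M.obj (i + 1)), e = 0

lemma IsStrongIdempotent.extQuotVanish (hA : IsStrongIdempotent A) (X : FGModuleCat.{u} (Λ ⧸ A)) :
    ExtQuotVanish A (inflate X) := by
  intro i e
  have : Projective (FGModuleCat.of (Λ ⧸ A) (Λ ⧸ A)).obj :=
    (IsProjective.iff_projective (R := Λ ⧸ A) (Λ ⧸ A)).1 inferInstance
  obtain ⟨e', rfl⟩ := (hA _ X (i + 1)).2 e
  rw [Abelian.Ext.eq_zero_of_projective e']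
  exact map_zero _

lemma ExtQuotVanish.isCosyzygy {M N : FGModuleCat.{u} Λ} (hM : ExtQuotVanish A M)
    (h : IsCosyzygy M N) : ExtQuotVanish A N := by
  intro i e
  obtain ⟨I, f, g, hI, hf, hfg, hg⟩ := h
  have hI' : Injective I.obj := (Module.injective_iff_injective_object Λ I).1 hI
  obtain ⟨x, rfl⟩ := Abelian.Ext.covariant_sequence_exact₃ _
    (shortExact_moduleCatMk hf hfg hg) e rfl (hM _ _)
  have hx : x = 0 := Abelian.Ext.eq_zero_of_injective (I := I.obj) x
  rw [hx, Abelian.Ext.zero_comp]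
  rfl

lemma ExtQuotVanish.exists_lift {M I N : FGModuleCat.{u} Λ} (hM : ExtQuotVanish A M)
    {f : M →ₗ[Λ] I} {g : I →ₗ[Λ] N} (hf : Function.Injective f) (hfg : Function.Exact f g)
    (hg : Function.Surjective g) (φ : inflate (FGModuleCat.of (Λ ⧸ A) (Λ ⧸ A)) →ₗ[Λ] N) :
    ∃ ψ : inflate (FGModuleCat.of (Λ ⧸ A) (Λ ⧸ A)) →ₗ[Λ] I, g ∘ₗ ψ = φ := by
  let φ' : (inflate (FGModuleCat.of (Λ ⧸ A) (Λ ⧸ A))).obj ⟶ N.obj := ConcreteCategory.ofHom φ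
  obtain ⟨x, hx⟩ := Abelian.Ext.covariant_sequence_exact₃ _
    (shortExact_moduleCatMk hf hfg hg) (Abelian.Ext.mk₀ φ') (zero_add 1) (hM _ _)
  obtain ⟨ψ, rfl⟩ := Abelian.Ext.homEquiv₀.symm.surjective x
  rw [Abelian.Ext.homEquiv₀_symm_apply, Abelian.Ext.mk₀_comp_mk₀] at hx
  exact ⟨ψ.hom, congrArg ModuleCat.Hom.hom ((Abelian.Ext.mk₀_bijective _ _).1 hx)⟩

variable [IsNoetherianRing Λ]

/-- An element of `{x | A x = 0}` is the value at `1` of a map from `Λ/A`, and such maps lift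
along `g`. -/
lemma ExtQuotVanish.coreflectMap_surjective {M I N : FGModuleCat.{u} Λ} (hM : ExtQuotVanish A M)
    {f : M →ₗ[Λ] I} {g : I →ₗ[Λ] N} (hf : Function.Injective f) (hfg : Function.Exact f g)
    (hg : Function.Surjective g) : Function.Surjective (coreflectMap A g) := by
  intro y
  let φ : inflate (FGModuleCat.of (Λ ⧸ A) (Λ ⧸ A)) →ₗ[Λ] inflate (coreflect A N) :=
    inflateHom (LinearMap.toSpanSingleton (Λ ⧸ A) (coreflect A N) y)
  obtain ⟨ψ, hψ⟩ := hM.exists_lift hf hfg hg (coreflectIncl A N ∘ₗ φ)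
  refine ⟨coreflectLift ψ (1 : Λ ⧸ A), coreflectIncl_injective N ?_⟩
  exact (LinearMap.congr_fun hψ (1 : Λ ⧸ A)).trans
    (congrArg (coreflectIncl A N) (one_smul (Λ ⧸ A) y))

lemma IsCosyzygy.coreflect {M N : FGModuleCat.{u} Λ} (hM : ExtQuotVanish A M)
    (h : IsCosyzygy M N) : IsCosyzygy (coreflect A M) (coreflect A N) := by
  obtain ⟨I, f, g, hI, hf, hfg, hg⟩ := h
  exact ⟨IgusaTodorov.coreflect A I, coreflectMap A f, coreflectMap A g, hI.coreflect,
    coreflectMap_injective hf, exact_coreflectMap hf hfg, hM.coreflectMap_surjective hf hfg hg⟩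

variable (A) in
/-- The homomorphism of stable groups induced by the coreflection. -/
def stableCoreflect : StableK (Inj (Λ := Λ)) →+ StableK (Inj (Λ := Λ ⧸ A)) :=
  stableLift (fun M => cls Inj (coreflect A M)) (fun _ _ _ e => cls_sum (coreflectProdEquiv A e))
    fun _ hZ => cls_null hZ.coreflect

lemma stableCoreflect_iterate_cls_inflate (hA : IsStrongIdempotent A)
    (hinj : HasEnoughFGInjectives.{u} Λ)
    {ω : StableK (Inj (Λ := Λ)) →+ StableK (Inj (Λ := Λ))}
    {ω' : StableK (Inj (Λ := Λ ⧸ A)) →+ StableK (Inj (Λ := Λ ⧸ A))}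
    (hω : IsInduced Inj IsCosyzygy ω) (hω' : IsInduced Inj IsCosyzygy ω')
    (X : FGModuleCat.{u} (Λ ⧸ A)) (s : ℕ) :
    stableCoreflect A (ω^[s] (cls Inj (inflate X))) = ω'^[s] (cls Inj X) := by
  have hcosyz (M : FGModuleCat.{u} Λ) (hM : ExtQuotVanish A M) :
      ∃ N, IsCosyzygy M N ∧ ExtQuotVanish A N ∧ IsCosyzygy (coreflect A M) (coreflect A N) := by
    obtain ⟨N, hN⟩ := hinj.exists_isCosyzygy M
    exact ⟨N, hN, hM.isCosyzygy hN, hN.coreflect hM⟩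
  rw [hω.map_iterate_cls hω' (t := stableCoreflect A) (stableLift_cls _ _ _) hcosyz s
    (hA.extQuotVanish X), cls_coreflect_inflate]

end CoreflectCosyzygy

section DirectSum

variable {Λ : Type u} [Ring Λ]

lemma hasProjectiveDimensionLT_of_moduleProjective (T : Type u) [AddCommGroup T] [Module Λ T]
    [Module.Projective Λ T] (n : ℕ) : HasProjectiveDimensionLT (ModuleCat.of Λ T) (n + 1) :=
  have := (IsProjective.iff_projective (R := Λ) T).1 inferInstance
  inferInstance

lemma hasInjectiveDimensionLT_of_moduleInjective (T : Type u) [AddCommGroup T] [Module Λ T]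
    (hT : Module.Injective Λ T) (n : ℕ) : HasInjectiveDimensionLT (ModuleCat.of Λ T) (n + 1) :=
  have := (Module.injective_iff_injective_object Λ T).1 hT
  inferInstance

lemma moduleProjective_of_hasProjectiveDimensionLT_one {T : Type u} [AddCommGroup T] [Module Λ T]
    (hT : HasProjectiveDimensionLT (ModuleCat.of Λ T) 1) : Module.Projective Λ T :=
  (IsProjective.iff_projective T).2 (projective_iff_hasProjectiveDimensionLT_one.2 hT)

lemma exact_finsupp_mapRange {L E M : Type u} [AddCommGroup L] [AddCommGroup E] [AddCommGroup M]
    [Module Λ L] [Module Λ E] [Module Λ M] {f : L →ₗ[Λ] E} {g : E →ₗ[Λ] M}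
    (hf : Function.Injective f) (hfg : Function.Exact f g) (κ : Type u) :
    Function.Exact (Finsupp.mapRange.linearMap (α := κ) f) (Finsupp.mapRange.linearMap g) := by
  rw [LinearMap.exact_iff] at hfg ⊢
  rw [Finsupp.ker_mapRange, Finsupp.range_mapRange_linearMap f (LinearMap.ker_eq_bot.2 hf), hfg]

lemma projective_finsupp (T : Type u) [AddCommGroup T] [Module Λ T] [Module.Projective Λ T]
    (κ : Type u) : Module.Projective Λ (κ →₀ T) := by
  classical
  exact Module.Projective.of_equiv (finsuppLequivDFinsupp (ι := κ) (M := T) Λ).symm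

lemma exists_free_hasProjectiveDimensionLT_ker (T : Type u) [AddCommGroup T] [Module Λ T] {n : ℕ}
    (hT : HasProjectiveDimensionLT (ModuleCat.of Λ T) (n + 2)) :
    ∃ p : (T →₀ Λ) →ₗ[Λ] T, Function.Surjective p ∧
      HasProjectiveDimensionLT (ModuleCat.of Λ p.ker) (n + 1) := by
  have hp := Finsupp.linearCombination_surjective Λ (v := (id : T → T)) Function.surjective_id
  exact ⟨Finsupp.linearCombination Λ id, hp,
    (shortExact_moduleCatMk (Submodule.injective_subtype _) (LinearMap.exact_subtype_ker_map _)
      hp).hasProjectiveDimensionLT_X₁ (n + 1)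
        (hasProjectiveDimensionLT_of_moduleProjective _ n) hT⟩

lemma hasProjectiveDimensionLT_finsupp {n : ℕ} {T : Type u} [AddCommGroup T] [Module Λ T]
    (hT : HasProjectiveDimensionLT (ModuleCat.of Λ T) (n + 1)) (κ : Type u) :
    HasProjectiveDimensionLT (ModuleCat.of Λ (κ →₀ T)) (n + 1) := by
  induction n generalizing T with
  | zero =>
    have := moduleProjective_of_hasProjectiveDimensionLT_one hT
    have := projective_finsupp (Λ := Λ) T κ
    exact hasProjectiveDimensionLT_of_moduleProjective (κ →₀ T) 0
  | succ n ih =>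
    obtain ⟨p, hp, hK⟩ := exists_free_hasProjectiveDimensionLT_ker T hT
    have := projective_finsupp (Λ := Λ) (T →₀ Λ) κ
    exact (shortExact_moduleCatMk
      (Finsupp.mapRange_injective _ (map_zero _) (Submodule.injective_subtype _))
      (exact_finsupp_mapRange (Submodule.injective_subtype _)
        (LinearMap.exact_subtype_ker_map p) κ)
      (Finsupp.mapRange_surjective _ (map_zero _) hp)).hasProjectiveDimensionLT_X₃ (n + 1) (ih hK)
      (hasProjectiveDimensionLT_of_moduleProjective _ (n + 1))

end DirectSum

section Character

variable {Λ : Type u} [Ring Λ]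

/-- The left module of characters `T → ℚ/ℤ` of a right module `T`, on which `a` acts by
precomposition with the right multiplication by `a`. -/
scoped instance instModuleCharacterModule (T : Type u) [AddCommGroup T] [Module Λᵐᵒᵖ T] :
    Module Λ (CharacterModule T) where
  smul a c := c.comp (DistribSMul.toAddMonoidHom T (MulOpposite.op a))
  one_smul c := CharacterModule.ext T fun t => congrArg c (one_smul _ t)
  mul_smul a b c := CharacterModule.ext T fun t => congrArg c
    (mul_smul (MulOpposite.op b) (MulOpposite.op a) t)
  smul_zero _ := rfl
  smul_add _ _ _ := rfl
  add_smul a b c := CharacterModule.ext T fun t =>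
    (congrArg c (add_smul (MulOpposite.op a) (MulOpposite.op b) t)).trans (map_add c _ _)
  zero_smul c := CharacterModule.ext T fun t =>
    (congrArg c (zero_smul Λᵐᵒᵖ t)).trans (map_zero c)

lemma smul_character_apply {T : Type u} [AddCommGroup T] [Module Λᵐᵒᵖ T] (a : Λ)
    (c : CharacterModule T) (t : T) : (a • c) t = c (MulOpposite.op a • t) := rfl

section Transpose

variable {S T U : Type u} [AddCommGroup S] [AddCommGroup T] [AddCommGroup U]
  [Module Λᵐᵒᵖ S] [Module Λᵐᵒᵖ T] [Module Λᵐᵒᵖ U]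

/-- The transpose of a homomorphism of right modules. -/
def charDual (f : S →ₗ[Λᵐᵒᵖ] T) : CharacterModule T →ₗ[Λ] CharacterModule S where
  toFun c := c.comp f.toAddMonoidHom
  map_add' _ _ := rfl
  map_smul' a c := CharacterModule.ext S fun s =>
    (congrArg c (f.map_smul (MulOpposite.op a) s)).symm

lemma charDual_injective {f : S →ₗ[Λᵐᵒᵖ] T} (hf : Function.Surjective f) :
    Function.Injective (charDual f) :=
  CharacterModule.dual_injective_of_surjective f.toAddMonoidHom.toIntLinearMap hf

lemma charDual_surjective {f : S →ₗ[Λᵐᵒᵖ] T} (hf : Function.Injective f) :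
    Function.Surjective (charDual f) :=
  CharacterModule.dual_surjective_of_injective f.toAddMonoidHom.toIntLinearMap hf

lemma exact_charDual {f : S →ₗ[Λᵐᵒᵖ] T} {g : T →ₗ[Λᵐᵒᵖ] U} (hfg : Function.Exact f g)
    (hg : Function.Surjective g) : Function.Exact (charDual g) (charDual f) := by
  intro c
  constructor
  · intro hc
    have hker : g.toAddMonoidHom.ker ≤ AddMonoidHom.ker c := fun t ht => by
      obtain ⟨s, rfl⟩ := (hfg t).1 ht
      exact DFunLike.congr_fun hc s
    exact ⟨g.toAddMonoidHom.liftOfSurjective hg ⟨c, hker⟩, CharacterModule.ext T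
      (g.toAddMonoidHom.liftOfRightInverse_comp_apply _ (Function.rightInverse_surjInv hg) _)⟩
  · rintro ⟨d, rfl⟩
    exact CharacterModule.ext S fun s =>
      (congrArg d (hfg.apply_apply_eq_zero s)).trans (map_zero d)

end Transpose

section Free

variable {κ X : Type u} [AddCommGroup X] [Module Λ X]

/-- The character of the free right module on `κ` sending `single k a` to `c k (a • x)`. -/
def freeDualCharacter (c : κ → CharacterModule X) (x : X) : CharacterModule (κ →₀ Λ) :=
  Finsupp.liftAddHom fun k => AddMonoidHom.comp (c k)
    (LinearMap.toSpanSingleton Λ X x).toAddMonoidHom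

lemma freeDualCharacter_single (c : κ → CharacterModule X) (x : X) (k : κ) (a : Λ) :
    freeDualCharacter c x (Finsupp.single k a) = c k (a • x) :=
  Finsupp.liftAddHom_apply_single _ _ _

/-- The homomorphism into the character module of the free right module on `κ` corresponding to a
family of characters indexed by `κ`. -/
def freeDualLift (c : κ → CharacterModule X) : X →ₗ[Λ] CharacterModule (κ →₀ Λ) where
  toFun := freeDualCharacter c
  map_add' x y := Finsupp.addHom_ext fun k a => by
    refine (freeDualCharacter_single c (x + y) k a).trans ?_
    rw [smul_add, map_add, ← freeDualCharacter_single, ← freeDualCharacter_single]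
    rfl
  map_smul' b x := Finsupp.addHom_ext fun k a => by
    refine (freeDualCharacter_single c (b • x) k a).trans ?_
    rw [smul_smul, ← freeDualCharacter_single]
    exact congrArg (freeDualCharacter c x) (Finsupp.smul_single (MulOpposite.op b) k a).symm

lemma freeDualLift_single (c : κ → CharacterModule X) (x : X) (k : κ) (a : Λ) :
    freeDualLift c x (Finsupp.single k a) = c k (a • x) :=
  freeDualCharacter_single c x k a

lemma characterModule_free_apply_single (h : X →ₗ[Λ] CharacterModule (κ →₀ Λ)) (x : X) (k : κ)
    (a : Λ) : h x (Finsupp.single k a) = h (a • x) (Finsupp.single k 1) := by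
  rw [map_smul, smul_character_apply, Finsupp.smul_single, op_smul_eq_mul, one_mul]

lemma freeDualLift_id_injective :
    Function.Injective (freeDualLift (Λ := Λ) (id : CharacterModule X → CharacterModule X)) := by
  refine (injective_iff_map_eq_zero _).2 fun x hx =>
    CharacterModule.eq_zero_of_character_apply fun c => ?_
  have h := DFunLike.congr_fun hx (Finsupp.single c (1 : Λ))
  rwa [freeDualLift_single, one_smul] at h

end Free

variable (Λ) in
lemma injective_characterModule_free (κ : Type u) :
    Module.Injective Λ (CharacterModule (κ →₀ Λ)) := by
  refine ⟨fun X Y _ _ _ _ i hi f => ?_⟩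
  have hext : ∀ k, ∃ d : CharacterModule Y, ∀ x, d (i x) = f x (Finsupp.single k 1) := fun k => by
    obtain ⟨d, hd⟩ := CharacterModule.dual_surjective_of_injective i.toAddMonoidHom.toIntLinearMap
      hi ((AddMonoidHom.eval (Finsupp.single k (1 : Λ))).comp f.toAddMonoidHom)
    exact ⟨d, DFunLike.congr_fun hd⟩
  choose d hd using hext
  refine ⟨freeDualLift d, fun x => Finsupp.addHom_ext fun k a => ?_⟩
  refine (freeDualLift_single d (i x) k a).trans ?_
  rw [← map_smul, hd]
  exact (characterModule_free_apply_single f x k a).symm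

lemma injective_of_leftInverse {I J : Type u} [AddCommGroup I] [AddCommGroup J] [Module Λ I]
    [Module Λ J] (hJ : Module.Injective Λ J) {s : I →ₗ[Λ] J} {r : J →ₗ[Λ] I}
    (hrs : Function.LeftInverse r s) : Module.Injective Λ I := by
  refine ⟨fun X Y _ _ _ _ i hi f => ?_⟩
  obtain ⟨h, hh⟩ := hJ.out i hi (s ∘ₗ f)
  exact ⟨r ∘ₗ h, fun x => (congrArg r (hh x)).trans (hrs (f x))⟩

lemma injective_characterModule (T : Type u) [AddCommGroup T] [Module Λᵐᵒᵖ T]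
    [Module.Projective Λᵐᵒᵖ T] : Module.Injective Λ (CharacterModule T) := by
  obtain ⟨s, hs⟩ := Module.Projective.out (R := Λᵐᵒᵖ) (P := T)
  let e : (T →₀ Λ) ≃ₗ[Λᵐᵒᵖ] (T →₀ Λᵐᵒᵖ) :=
    Finsupp.mapRange.linearEquiv (MulOpposite.opLinearEquiv Λᵐᵒᵖ)
  have hes (t : T) : Finsupp.linearCombination Λᵐᵒᵖ id (e (e.symm (s t))) = t := by
    rw [e.apply_symm_apply, hs]
  exact injective_of_leftInverse (injective_characterModule_free Λ T)
    (s := charDual (Finsupp.linearCombination Λᵐᵒᵖ id ∘ₗ e.toLinearMap))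
    (r := charDual (e.symm.toLinearMap ∘ₗ s))
    fun c => CharacterModule.ext T fun t => congrArg c (hes t)

lemma hasInjectiveDimensionLT_characterModule {n : ℕ} {T : Type u} [AddCommGroup T]
    [Module Λᵐᵒᵖ T] (hT : HasProjectiveDimensionLT (ModuleCat.of Λᵐᵒᵖ T) (n + 1)) :
    HasInjectiveDimensionLT (ModuleCat.of Λ (CharacterModule T)) (n + 1) := by
  induction n generalizing T with
  | zero =>
    have := moduleProjective_of_hasProjectiveDimensionLT_one hT
    exact hasInjectiveDimensionLT_of_moduleInjective _ (injective_characterModule T) 0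
  | succ n ih =>
    obtain ⟨p, hp, hK⟩ := exists_free_hasProjectiveDimensionLT_ker T hT
    exact (shortExact_moduleCatMk (charDual_injective hp)
      (exact_charDual (LinearMap.exact_subtype_ker_map p) hp)
      (charDual_surjective p.ker.injective_subtype)).hasInjectiveDimensionLT_X₁ (n + 1) (ih hK)
      (hasInjectiveDimensionLT_of_moduleInjective _ (injective_characterModule _) (n + 1))

lemma hasInjectiveDimensionLT_characterModule_finsupp {n : ℕ} {Q : ModuleCat.{u} Λᵐᵒᵖ}
    (hQ : HasProjectiveDimensionLT Q (n + 1)) (κ : Type u) :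
    HasInjectiveDimensionLT (ModuleCat.of Λ (CharacterModule (κ →₀ Q))) (n + 1) :=
  hasInjectiveDimensionLT_characterModule (hasProjectiveDimensionLT_finsupp hQ κ)

end Character

section Inflate

variable {Λ : Type u} [Ring Λ]

/-- A linear map with a left inverse, as a retract in the category of modules. -/
def retractOfLeftInverse {X Y : Type u} [AddCommGroup X] [AddCommGroup Y] [Module Λ X]
    [Module Λ Y] (s : X →ₗ[Λ] Y) (r : Y →ₗ[Λ] X) (h : Function.LeftInverse r s) :
    Retract (ModuleCat.of Λ X) (ModuleCat.of Λ Y) where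
  i := ModuleCat.ofHom s
  r := ModuleCat.ofHom r
  retract := ModuleCat.hom_ext (LinearMap.ext h)

variable {A : Ideal Λ} [A.IsTwoSided] {n : ℕ}

lemma hasProjectiveDimensionLT_inflate (hn : HasProjectiveDimensionLT (leftQuot A) (n + 1))
    {P : FGModuleCat.{u} (Λ ⧸ A)} (hP : Proj P) :
    HasProjectiveDimensionLT (inflate P).obj (n + 1) := by
  obtain ⟨s, hs⟩ := hP.out
  have hr : Retract (inflate P).obj (ModuleCat.of Λ (P →₀ Λ ⧸ A)) :=
    (retractOfLeftInverse s _ hs).map (incl A)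
  have := hasProjectiveDimensionLT_finsupp hn P
  exact hr.hasProjectiveDimensionLT (n + 1)

lemma hasInjectiveDimensionLT_inflate (hn : HasProjectiveDimensionLT (rightQuot A) (n + 1))
    {I : FGModuleCat.{u} (Λ ⧸ A)} (hI : Inj I) :
    HasInjectiveDimensionLT (inflate I).obj (n + 1) := by
  let s := freeDualLift (Λ := Λ ⧸ A) (id : CharacterModule I → CharacterModule I)
  obtain ⟨r, hrs⟩ := hI.out s freeDualLift_id_injective LinearMap.id
  exact @Retract.hasInjectiveDimensionLT _ _ _ _ _ ((retractOfLeftInverse s r hrs).map (incl A))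
    (n + 1) (hasInjectiveDimensionLT_characterModule_finsupp hn (CharacterModule I))

end Inflate

section Comparison

variable {Λ : Type u} [Ring Λ] {A : Ideal Λ} [A.IsTwoSided]

lemma IsExtension.inflate {L E M : FGModuleCat.{u} (Λ ⧸ A)} (h : IsExtension L E M) :
    IsExtension (inflate L) (inflate E) (inflate M) := by
  obtain ⟨f, g, hf, hfg, hg⟩ := h
  exact ⟨inflateHom f, inflateHom g, hf, hfg, hg⟩

theorem phiL_le_phiL_inflate [IsNoetherianRing Λ] (hinj : HasEnoughFGInjectives.{u} (Λ ⧸ A))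
    (hA : IsStrongIdempotent A) (hpd : projectiveDimension (leftQuot A) < ⊤)
    (X : FGModuleCat.{u} (Λ ⧸ A)) : phiL X ≤ phiL (inflate X) := by
  obtain ⟨n, hn⟩ := (projectiveDimension_ne_top_iff _).1 hpd.ne
  have : IsNoetherianRing (Λ ⧸ A) :=
    isNoetherianRing_of_surjective Λ (Λ ⧸ A) (Ideal.Quotient.mk A) Ideal.Quotient.mk_surjective
  have hω := isInduced_inducedHom_syzygy (Λ := Λ)
  have hω' := isInduced_inducedHom_syzygy (Λ := Λ ⧸ A)
  have hnull {P : FGModuleCat.{u} (Λ ⧸ A)} (hP : Proj P) :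
      HasProjectiveDimensionLT (inflate P).obj (n + 1) :=
    hasProjectiveDimensionLT_inflate hn hP
  refine stabIndex_addSpan_le_inflate hω' n (stableReflect A)
    (stableReflect_iterate_cls_inflate hA hinj hω hω')
    (fun P hP => hω.iterate_cls_eq_zero (hnull hP)) (fun Y => ?_) X
  obtain ⟨Z, P, f, g, hP, h⟩ := exists_isSyzygy Y
  exact ⟨Z, ⟨P, f, g, hP, h⟩, (hω.iterate_succ_cls_of_isExtension
    (IsExtension.inflate ⟨f, g, h⟩) (hnull hP)).symm⟩

theorem phiR_le_phiR_inflate [IsNoetherianRing Λ] (hΛ : HasEnoughFGInjectives.{u} Λ)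
    (hA : IsStrongIdempotent A) (hpd : projectiveDimension (rightQuot A) < ⊤)
    (X : FGModuleCat.{u} (Λ ⧸ A)) : phiR X ≤ phiR (inflate X) := by
  obtain ⟨n, hn⟩ := (projectiveDimension_ne_top_iff _).1 hpd.ne
  have hω := isInduced_inducedHom (existsUnique_isInduced_cosyzygy_of_enough hΛ).exists
  have hω' := isInduced_inducedHom
    (existsUnique_isInduced_cosyzygy_of_enough (hΛ.quotient (A := A))).exists
  have hnull {I : FGModuleCat.{u} (Λ ⧸ A)} (hI : Inj I) :
      HasInjectiveDimensionLT (inflate I).obj (n + 1) :=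
    hasInjectiveDimensionLT_inflate hn hI
  refine stabIndex_addSpan_le_inflate hω' n (stableCoreflect A)
    (stableCoreflect_iterate_cls_inflate hA hΛ hω hω')
    (fun I hI => hω.iterate_cls_eq_zero_cosyzygy hΛ (hnull hI)) (fun Y => ?_) X
  obtain ⟨Z, I, f, g, hI, h⟩ := hΛ.quotient.exists_isCosyzygy Y
  exact ⟨Z, ⟨I, f, g, hI, h⟩, (hω.iterate_succ_cls_of_isExtension_cosyzygy hΛ
    (IsExtension.inflate ⟨f, g, h⟩) (hnull hI)).symm⟩

end Comparison

lemma hasEnoughFGInjectives_of_artinAlgebra (R : Type v) [CommRing R] [IsArtinianRing R]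
    (Λ : Type u) [Ring Λ] [Algebra R Λ] [Module.Finite R Λ] : HasEnoughFGInjectives.{u} Λ := by
  intro M
  have := ModuleCat.enoughInjectives.{u, u} Λ
  obtain ⟨⟨E, hE, i, hi⟩⟩ := EnoughInjectives.presentation M.obj
  have hE' : Module.Injective Λ E := (Module.injective_iff_injective_object Λ E).2 hE
  have hi' : Function.Injective i.hom := (ModuleCat.mono_iff_injective i).1 hi
  obtain ⟨N, hMN, hess, hN⟩ := exists_hull i.hom.range
  have hrange : i.hom.range.FG := by
    rw [← Submodule.map_top]
    exact Module.Finite.fg_top.map _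
  have := finite_of_essOver R i.hom.range N hrange hess
  exact ⟨FGModuleCat.of Λ N, i.hom.codRestrict N fun x => hMN ⟨x, rfl⟩, hN,
    fun x y h => hi' (congrArg Subtype.val h)⟩

theorem theorem4p3_general (Λ : Type u) [Ring Λ] [IsNoetherianRing Λ]
    (hΛ : HasEnoughFGInjectives.{u} Λ) (A : Ideal Λ) [A.IsTwoSided] (hA : IsStrongIdempotent A) :
    (projectiveDimension (leftQuot A) < ⊤ →
      (∀ X : FGModuleCat.{u} (Λ ⧸ A), phiL X ≤ phiL (inflate X)) ∧
        phiLDim (Λ ⧸ A) ≤ phiLDim Λ) ∧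
    (projectiveDimension (rightQuot A) < ⊤ →
      (∀ X : FGModuleCat.{u} (Λ ⧸ A), phiR X ≤ phiR (inflate X)) ∧
        phiRDim (Λ ⧸ A) ≤ phiRDim Λ) := by
  refine ⟨fun hpd => ?_, fun hpd => ?_⟩
  · have h := phiL_le_phiL_inflate hΛ.quotient hA hpd
    exact ⟨h, iSup_le fun X => (h X).trans (le_iSup phiL (inflate X))⟩
  · have h := phiR_le_phiR_inflate hΛ hA hpd
    exact ⟨h, iSup_le fun X => (h X).trans (le_iSup phiR (inflate X))⟩

end

end IgusaTodorov

open IgusaTodorov in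
theorem theorem4p3 (R : Type v) [CommRing R] [IsArtinianRing R]
    (Λ : Type u) [Ring Λ] [Algebra R Λ] [Module.Finite R Λ]
    (A : Ideal Λ) [A.IsTwoSided] (hA : IsStrongIdempotent A) :
    (projectiveDimension (leftQuot A) < ⊤ →
      (∀ X : FGModuleCat.{u} (Λ ⧸ A), phiL X ≤ phiL (inflate X)) ∧
        phiLDim (Λ ⧸ A) ≤ phiLDim Λ) ∧
    (projectiveDimension (rightQuot A) < ⊤ →
      (∀ X : FGModuleCat.{u} (Λ ⧸ A), phiR X ≤ phiR (inflate X)) ∧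
        phiRDim (Λ ⧸ A) ≤ phiRDim Λ) := by
  have : IsArtinianRing Λ := IsArtinianRing.of_finite R Λ
  exact theorem4p3_general Λ (hasEnoughFGInjectives_of_artinAlgebra R Λ) A hA
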